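/- Let $k$ be a field. Coalgebras are over $k$, and Sweedler notation is used throughout. **Hopf algebroids.** A Hopf algebroid $\mathcal U=(U,A,s,t,\Delta,\epsilon,S)$ over $k$ consists of unital $k$-algebras $U$, $A$ and algebra maps $s:A\to U$, $t:A^{op}\to U$ with commuting images. Here $U$ is an $(A,A)$-bimodule by $a\cdot u\cdot b=s(a)t(b)u$. There is a coalgebra structure $\Delta:U\to U\otimes_A U$, $\epsilon:U\to A$ in $(A,A)$-bimodules such that $\Delta$ is a morphism of unital algebras into the Takeuchi product $U\times_A U=\{\sum u_i\otimes u_i' : \sum u_it(a)\otimes u_i'=\sum u_i\otimes u_i's(a)\ \forall a\in A\}$ and $\epsilon(us(\epsilon(u')))=\epsilon(uu')=\epsilon(ut(\epsilon(u')))$. Finally, $S$ is an involutive anti-automorphism of the $k$-algebra $U$ with $S\circ t=s$, $S(u_{(1)})_{(1)}u_{(2)}\otimes S(u_{(1)})_{(2)}=1\otimes S(u)$ and $S(u_{(2)})_{(1)}\otimes S(u_{(2)})_{(2)}u_{(1)}=S(u)\otimes 1$ in $U\otimes_AU$. Let $u_+\otimes u_-$ denote the preimage of $u\otimes_A1$ under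 the (bijective) Hopf–Galois map $U\otimes_{A^{op}}U\to U\otimes_AU$, $u\otimes v\mapsto u_{(1)}\otimes u_{(2)}v$, where $U\otimes_{A^{op}}U=U\otimes_kU/\langle ut(a)\otimes v-u\otimes t(a)v\rangle$. **SAYD modules.** A stable anti-Yetter–Drinfeld (SAYD) module over $\mathcal U$ is a right $U$-module $P$ that is also a left comodule over the $A$-coring $U$: it has a left $A$-module structure and a left $A$-linear, coassociative and counital coaction $\Delta_P:P\to U\otimes_AP$, $p\mapsto p_{(-1)}\otimes p_{(0)}$ (where $t(a)u\otimes p=u\otimes ap$). These satisfy, for all $p\in P$, $u\in U$ and $a,b\in A$, $$p\,s(a)t(b)=b\,\epsilon(p_{(-1)}s(a))\,p_{(0)},\qquad \Delta_P(pu)=u_-p_{(-1)}u_{+(1)}\otimes_A p_{(0)}u_{+(2)},\qquad p_{(0)}p_{(-1)}=p,$$ where $u_{+(1)}\otimes u_{+(2)}\otimes u_-$ is represented by $u_{(1)}\otimes u_{(2)+}\otimes u_{(2)-}$. **Measurings.** Let $C$ be a cocommutative coalgebra. A linear map $\psi:C\to \mathrm{Hom}_k(R,R')$ measures the algebra $R$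 to the algebra $R'$ if $\psi(x)(ab)=\psi(x_{(1)})(a)\psi(x_{(2)})(b)$ and $\psi(x)(1)=\epsilon_C(x)1$. A measuring $(\Psi,\psi)$ of Hopf algebroids from $\mathcal U$ to $\mathcal U'$ is a pair of measurings $\Psi:C\to \mathrm{Hom}_k(U,U')$, $\psi:C\to \mathrm{Hom}_k(A,A')$ such that, for all $x\in C$, $\Psi(x)s=s'\psi(x)$, $\Psi(x)t=t'\psi(x)$, $\Psi(x)S=S'\Psi(x)$, $\psi(x)\epsilon=\epsilon'\Psi(x)$ and $\Delta'(\Psi(x)(u))=\Psi(x_{(1)})(u_{(1)})\otimes\Psi(x_{(2)})(u_{(2)})$. Let $P$, $P'$ be SAYD modules over $\mathcal U$, $\mathcal U'$. A $(C,\Psi,\psi)$-comodule measuring from $P$ to $P'$ is a right $C$-comodule $D$ with a linear map $\Omega:D\to \mathrm{Hom}_k(P,P')$ such that $\Omega(y)(pu)=\Omega(y_{(0)})(p)\Psi(y_{(1)})(u)$ and $\Delta_{P'}(\Omega(y)(p))=\Psi(y_{(1)})(p_{(-1)})\otimes\Omega(y_{(0)})(p_{(0)})$. **Theorem.** (1)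 Let $(\Psi,\psi):C\to \mathrm{Hom}_k(U,U')\times\mathrm{Hom}_k(A,A')$ be a measuring of Hopf algebroids from $\mathcal U$ to $\mathcal U'$ with $C$ cocommutative, and let $P$, $P'$ be SAYD modules over $\mathcal U$, $\mathcal U'$. Then there is a universal $(C,\Psi,\psi)$-comodule measuring $\Theta:\mathcal Q_C(P,P')\to \mathrm{Hom}_k(P,P')$: for every $(C,\Psi,\psi)$-comodule measuring $\Omega:D\to \mathrm{Hom}_k(P,P')$ there is a unique morphism $\chi:D\to \mathcal Q_C(P,P')$ of right $C$-comodules with $\Theta\circ\chi=\Omega$. Moreover $\mathcal Q_C(P,P')$ is a subcomodule of the cofree right $C$-comodule $\mathrm{Hom}_k(P,P')\otimes C$ on $\mathrm{Hom}_k(P,P')$, and $\Theta$ is the restriction of the canonical map $\mathrm{id}\otimes\epsilon_C$. (2) For all Hopf algebroids $\mathcal U$, $\mathcal U'$ there is a universal measuring $(\Phi,\phi)$ from $\mathcal U$ to $\mathcal U'$ with a cocommutative coalgebra $\mathcal M_c(\mathcal U,\mathcal U')$: every measuring $(\Psi,\psi)$ from $\mathcal U$ to $\mathcal U'$ with cocommutative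 $C$ factors as $(\Phi\circ\xi,\phi\circ\xi)$ for a unique coalgebra map $\xi:C\to\mathcal M_c(\mathcal U,\mathcal U')$. (3) Let $Comod_k$ be the symmetric monoidal category of pairs $(C,D)$ with $C$ a cocommutative coalgebra and $D$ a right $C$-comodule. A morphism $(C,D)\to(C',D')$ is a coalgebra map $f:C\to C'$ together with a map $g:D\to D'$ of $C'$-comodules, where $D$ is corestricted along $f$; and $(C,D)\otimes(C',D')=(C\otimes C',D\otimes D')$. The pairs $(\mathcal U,P)$ of a Hopf algebroid $\mathcal U$ and an SAYD module $P$ over $\mathcal U$ are the objects of a category enriched over $Comod_k$, with hom-objects $$\big(\mathcal M_c(\mathcal U,\mathcal U'),\ \mathcal Q_{\mathcal M_c(\mathcal U,\mathcal U')}(P,P')\big)$$ formed with respect to the universal measuring $(\Phi,\phi)$. Its units $(k,k)\to\big(\mathcal M_c(\mathcal U,\mathcal U),\mathcal Q_{\mathcal M_c(\mathcal U,\mathcal U)}(P,P)\big)$ and its compositions are compatible under $\Phi$, $\phi$, $\Theta$ with scalar multiples of the identity and with the composition of linear maps. -/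

import Mathlib

open CategoryTheory MonoidalCategory TensorProduct MulOpposite

universe u

noncomputable section

namespace HopfMeasuring

/-! ### The global category of comodules -/

/-- A right comodule over a `k`-coalgebra `C`. -/
structure RightComodule (k C : Type u) [Field k] [AddCommGroup C] [Module k C]
    [Coalgebra k C] : Type (u + 1) where
  carrier : Type u
  [addCommGroup : AddCommGroup carrier]
  [module : Module k carrier]
  coact : carrier →ₗ[k] carrier ⊗[k] C
  coassoc : (TensorProduct.assoc k carrier C C).toLinearMap ∘ₗ coact.rTensor C ∘ₗ coact =
    (Coalgebra.comul (R := k) (A := C)).lTensor carrier ∘ₗ coact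
  counit : (Coalgebra.counit (R := k) (A := C)).lTensor carrier ∘ₗ coact =
    (TensorProduct.mk k carrier k).flip 1

attribute [instance] RightComodule.addCommGroup RightComodule.module

/-- An object of the global category of comodules: a cocommutative coalgebra together with a
right comodule over it. -/
structure ComodPair (k : Type u) [Field k] : Type (u + 1) where
  C : Type u
  [addCommGroup : AddCommGroup C]
  [module : Module k C]
  [coalgebra : Coalgebra k C]
  [isCocomm : Coalgebra.IsCocomm k C]
  D : RightComodule k C

attribute [instance] ComodPair.addCommGroup ComodPair.module ComodPair.coalgebra
  ComodPair.isCocomm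

namespace ComodPair

variable {k : Type u} [Field k]

/-- A morphism `(C, D) ⟶ (C', D')`: a coalgebra map `f : C → C'` and a linear map `g : D → D'`
that is a map of `C'`-comodules when `D` is corestricted along `f`, that is,
`g(y)₍₀₎ ⊗ g(y)₍₁₎ = g(y₍₀₎) ⊗ f(y₍₁₎)`. -/
structure Hom (X Y : ComodPair k) : Type u where
  f : X.C →ₗc[k] Y.C
  g : X.D.carrier →ₗ[k] Y.D.carrier
  comm : Y.D.coact ∘ₗ g = TensorProduct.map g f.toLinearMap ∘ₗ X.D.coact

instance : Category (ComodPair k) where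
  Hom := Hom
  id X := ⟨CoalgHom.id k X.C, LinearMap.id, by
    ext y; exact (LinearMap.congr_fun TensorProduct.map_id (X.D.coact y)).symm⟩
  comp {X Y Z} F G := ⟨G.f.comp F.f, G.g ∘ₗ F.g, by
    rw [← LinearMap.comp_assoc, G.comm, LinearMap.comp_assoc, F.comm, ← LinearMap.comp_assoc,
      ← TensorProduct.map_comp]
    rfl⟩

theorem hom_ext {X Y : ComodPair k} {F G : X ⟶ Y}
    (hf : F.f.toLinearMap = G.f.toLinearMap) (hg : F.g = G.g) : F = G := by
  obtain ⟨f, g, _⟩ := F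
  obtain ⟨f', g', _⟩ := G
  have h : f = f' := by ext x; exact LinearMap.congr_fun hf x
  subst h
  change g = g' at hg
  subst hg
  rfl

/-- Build an isomorphism of pairs from a coalgebra equivalence and a compatible linear
equivalence. -/
def mkIso {X Y : ComodPair k} (e : X.C ≃ₗc[k] Y.C) (d : X.D.carrier ≃ₗ[k] Y.D.carrier)
    (h : ∀ y, Y.D.coact (d y) =
      TensorProduct.map d.toLinearMap e.toCoalgHom.toLinearMap (X.D.coact y)) : X ≅ Y where
  hom := ⟨e.toCoalgHom, d.toLinearMap, LinearMap.ext h⟩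
  inv := ⟨e.symm.toCoalgHom, d.symm.toLinearMap, by
    ext y
    obtain ⟨x, rfl⟩ := d.surjective y
    have hx := h x
    simp only [LinearMap.comp_apply, LinearEquiv.coe_coe, LinearEquiv.symm_apply_apply]
    rw [hx, ← LinearMap.comp_apply, ← TensorProduct.map_comp]
    have h1 : d.symm.toLinearMap ∘ₗ d.toLinearMap = LinearMap.id := by ext; simp
    have h2 : e.symm.toCoalgHom.toLinearMap ∘ₗ e.toCoalgHom.toLinearMap = LinearMap.id := by
      ext z; exact e.symm_apply_apply z
    rw [h1, h2, TensorProduct.map_id]; rfl⟩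
  hom_inv_id := hom_ext (by ext z; exact e.symm_apply_apply z)
    (by ext z; exact d.symm_apply_apply z)
  inv_hom_id := hom_ext (by ext z; exact e.apply_symm_apply z)
    (by ext z; exact d.apply_symm_apply z)

/-- The coaction `y ⊗ y' ↦ (y₍₀₎ ⊗ y'₍₀₎) ⊗ (y₍₁₎ ⊗ y'₍₁₎)`. -/
def tensorCoact (X Y : ComodPair k) :
    X.D.carrier ⊗[k] Y.D.carrier →ₗ[k]
      (X.D.carrier ⊗[k] Y.D.carrier) ⊗[k] (X.C ⊗[k] Y.C) :=
  (TensorProduct.tensorTensorTensorComm k X.D.carrier X.C Y.D.carrier Y.C).toLinearMap ∘ₗ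
    TensorProduct.map X.D.coact Y.D.coact

/-- `D ⊗ D'` as a comodule over `C ⊗ C'`. -/
def tensorD (X Y : ComodPair k) : RightComodule k (X.C ⊗[k] Y.C) where
  carrier := X.D.carrier ⊗[k] Y.D.carrier
  coact := tensorCoact X Y
  coassoc := by
    apply TensorProduct.ext'
    intro x y
    let F := (TensorProduct.tensorTensorTensorComm k X.D.carrier (X.C ⊗[k] X.C)
        Y.D.carrier (Y.C ⊗[k] Y.C)) ≪≫ₗ
      (TensorProduct.congr (LinearEquiv.refl k _)
        (TensorProduct.tensorTensorTensorComm k X.C X.C Y.C Y.C))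
    have h1 : ∀ (z : X.D.carrier ⊗[k] X.C) (w : Y.D.carrier ⊗[k] Y.C),
        TensorProduct.assoc k _ _ _ ((tensorCoact X Y).rTensor (X.C ⊗[k] Y.C)
          (TensorProduct.tensorTensorTensorComm k _ _ _ _ (z ⊗ₜ w))) =
        F ((TensorProduct.assoc k _ _ _ (X.D.coact.rTensor _ z)) ⊗ₜ
          (TensorProduct.assoc k _ _ _ (Y.D.coact.rTensor _ w))) := by
      intro z w
      induction z with
      | zero => simp
      | add a b ha hb => simp only [add_tmul, map_add, ha, hb]
      | tmul d c =>
        induction w with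
        | zero => simp
        | add a b ha hb => simp only [tmul_add, map_add, ha, hb]
        | tmul d' c' =>
          simp only [TensorProduct.tensorTensorTensorComm_tmul, LinearMap.rTensor_tmul,
            tensorCoact, LinearMap.comp_apply, TensorProduct.map_tmul, LinearEquiv.coe_coe]
          generalize X.D.coact d = p
          generalize Y.D.coact d' = q
          induction p with
          | zero => simp
          | add a b ha hb => simp only [add_tmul, map_add, ha, hb]
          | tmul p1 p2 =>
            induction q with
            | zero => simp
            | add a b ha hb => simp only [add_tmul, tmul_add, map_add, ha, hb]
            | tmul q1 q2 => simp [F]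
    have h2 : ∀ (z : X.D.carrier ⊗[k] X.C) (w : Y.D.carrier ⊗[k] Y.C),
        (Coalgebra.comul (R := k) (A := X.C ⊗[k] Y.C)).lTensor _
          (TensorProduct.tensorTensorTensorComm k _ _ _ _ (z ⊗ₜ w)) =
        F (((Coalgebra.comul (R := k) (A := X.C)).lTensor _ z) ⊗ₜ
          ((Coalgebra.comul (R := k) (A := Y.C)).lTensor _ w)) := by
      intro z w
      induction z with
      | zero => simp
      | add a b ha hb => simp only [add_tmul, map_add, ha, hb]
      | tmul d c =>
        induction w with
        | zero => simp
        | add a b ha hb => simp only [tmul_add, map_add, ha, hb]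
        | tmul d' c' =>
          simp [F, TensorProduct.AlgebraTensorModule.tensorTensorTensorComm_eq]
    have hx := LinearMap.congr_fun X.D.coassoc x
    have hy := LinearMap.congr_fun Y.D.coassoc y
    simp only [LinearMap.comp_apply, LinearEquiv.coe_coe] at hx hy
    change TensorProduct.assoc k _ _ _ ((tensorCoact X Y).rTensor (X.C ⊗[k] Y.C)
      (TensorProduct.tensorTensorTensorComm k _ _ _ _ (X.D.coact x ⊗ₜ Y.D.coact y))) =
      (Coalgebra.comul (R := k) (A := X.C ⊗[k] Y.C)).lTensor _
        (TensorProduct.tensorTensorTensorComm k _ _ _ _ (X.D.coact x ⊗ₜ Y.D.coact y))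
    rw [h1, h2, hx, hy]
  counit := by
    apply TensorProduct.ext'
    intro x y
    have h : ∀ (z : X.D.carrier ⊗[k] X.C) (w : Y.D.carrier ⊗[k] Y.C),
        (Coalgebra.counit (R := k) (A := X.C ⊗[k] Y.C)).lTensor _
          (TensorProduct.tensorTensorTensorComm k _ _ _ _ (z ⊗ₜ w)) =
        (TensorProduct.congr (LinearEquiv.refl k _) (TensorProduct.lid k k))
          (TensorProduct.tensorTensorTensorComm k _ _ _ _
          (((Coalgebra.counit (R := k) (A := X.C)).lTensor _ z) ⊗ₜ
          ((Coalgebra.counit (R := k) (A := Y.C)).lTensor _ w))) := by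
      intro z w
      induction z with
      | zero => simp
      | add a b ha hb => simp only [add_tmul, map_add, ha, hb]
      | tmul d c =>
        induction w with
        | zero => simp
        | add a b ha hb => simp only [tmul_add, map_add, ha, hb]
        | tmul d' c' => simp [mul_comm]
    have hx := LinearMap.congr_fun X.D.counit x
    have hy := LinearMap.congr_fun Y.D.counit y
    simp only [LinearMap.comp_apply] at hx hy
    change (Coalgebra.counit (R := k) (A := X.C ⊗[k] Y.C)).lTensor _
        (TensorProduct.tensorTensorTensorComm k _ _ _ _ (X.D.coact x ⊗ₜ Y.D.coact y)) = _
    rw [h, hx, hy]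
    simp

/-- `k` as a comodule over itself. -/
def unitD : RightComodule k k where
  carrier := k
  coact := Coalgebra.comul
  coassoc := Coalgebra.coassoc
  counit := Coalgebra.lTensor_counit_comp_comul

/-- The tensor product of objects, `(C, D) ⊗ (C', D') = (C ⊗ C', D ⊗ D')`. -/
def tensorPair (X Y : ComodPair k) : ComodPair k where
  C := X.C ⊗[k] Y.C
  D := tensorD X Y

/-- The tensor product of morphisms. -/
def tensorPairHom {X₁ Y₁ X₂ Y₂ : ComodPair k} (F : X₁ ⟶ Y₁) (G : X₂ ⟶ Y₂) :
    tensorPair X₁ X₂ ⟶ tensorPair Y₁ Y₂ :=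
  ⟨Coalgebra.TensorProduct.map F.f G.f, TensorProduct.map F.g G.g, by
    apply TensorProduct.ext'
    intro x y
    have h : ∀ (z : X₁.D.carrier ⊗[k] X₁.C) (w : X₂.D.carrier ⊗[k] X₂.C),
      TensorProduct.tensorTensorTensorComm k _ _ _ _
        (TensorProduct.map F.g F.f.toLinearMap z ⊗ₜ TensorProduct.map G.g G.f.toLinearMap w) =
      TensorProduct.map (TensorProduct.map F.g G.g)
        (Coalgebra.TensorProduct.map F.f G.f).toLinearMap
        (TensorProduct.tensorTensorTensorComm k _ _ _ _ (z ⊗ₜ w)) := by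
      intro z w
      induction z with
      | zero => simp
      | add a b ha hb => simp only [add_tmul, map_add, ha, hb]
      | tmul d c =>
        induction w with
        | zero => simp
        | add a b ha hb => simp only [tmul_add, map_add, ha, hb]
        | tmul d' c' => rfl
    refine Eq.trans ?_ (h (X₁.D.coact x) (X₂.D.coact y))
    rw [show TensorProduct.map F.g F.f.toLinearMap (X₁.D.coact x) = Y₁.D.coact (F.g x) from
      (LinearMap.congr_fun F.comm x).symm,
      show TensorProduct.map G.g G.f.toLinearMap (X₂.D.coact y) = Y₂.D.coact (G.g y) from
      (LinearMap.congr_fun G.comm y).symm]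
    rfl⟩

/-- The associator. -/
def assocIso (X Y Z : ComodPair k) :
    tensorPair (tensorPair X Y) Z ≅ tensorPair X (tensorPair Y Z) :=
  mkIso (X := tensorPair (tensorPair X Y) Z) (Y := tensorPair X (tensorPair Y Z))
    (Coalgebra.TensorProduct.assoc k k X.C Y.C Z.C)
    (TensorProduct.assoc k X.D.carrier Y.D.carrier Z.D.carrier) (by
    intro y
    refine LinearMap.congr_fun (f := (tensorPair X (tensorPair Y Z)).D.coact ∘ₗ
      (TensorProduct.assoc k X.D.carrier Y.D.carrier Z.D.carrier).toLinearMap)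
      (g := TensorProduct.map _ _ ∘ₗ (tensorPair (tensorPair X Y) Z).D.coact) ?_ y
    apply TensorProduct.ext_threefold
    intro a b c
    change TensorProduct.tensorTensorTensorComm k _ _ _ _ (X.D.coact a ⊗ₜ
        TensorProduct.tensorTensorTensorComm k _ _ _ _ (Y.D.coact b ⊗ₜ Z.D.coact c)) =
      TensorProduct.map (TensorProduct.assoc k _ _ _).toLinearMap
        (TensorProduct.assoc k _ _ _).toLinearMap
        (TensorProduct.tensorTensorTensorComm k _ _ _ _
          (TensorProduct.tensorTensorTensorComm k _ _ _ _ (X.D.coact a ⊗ₜ Y.D.coact b) ⊗ₜ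
            Z.D.coact c))
    generalize X.D.coact a = p
    generalize Y.D.coact b = q
    generalize Z.D.coact c = r
    induction p with
    | zero => simp
    | add a b ha hb => simp only [add_tmul, map_add, ha, hb]
    | tmul p1 p2 =>
      induction q with
      | zero => simp
      | add a b ha hb => simp only [add_tmul, tmul_add, map_add, ha, hb]
      | tmul q1 q2 =>
        induction r with
        | zero => simp
        | add a b ha hb => simp only [tmul_add, map_add, ha, hb]
        | tmul r1 r2 => rfl)

/-- The unit object `(k, k)`. -/
def unitPair : ComodPair k where
  C := k
  D := unitD

/-- The left unitor. -/
def leftIso (X : ComodPair k) : tensorPair unitPair X ≅ X :=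
  mkIso (X := tensorPair unitPair X) (Coalgebra.TensorProduct.lid k X.C)
    (TensorProduct.lid k X.D.carrier) (by
    intro y
    refine LinearMap.congr_fun (f := X.D.coact ∘ₗ (TensorProduct.lid k X.D.carrier).toLinearMap)
      (g := TensorProduct.map _ _ ∘ₗ (tensorPair unitPair X).D.coact) ?_ y
    apply TensorProduct.ext'
    intro a b
    change X.D.coact (a • b) = TensorProduct.map (TensorProduct.lid k _).toLinearMap
      (TensorProduct.lid k _).toLinearMap
      (TensorProduct.tensorTensorTensorComm k _ _ _ _
        (Coalgebra.comul (R := k) (A := k) a ⊗ₜ X.D.coact b))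
    rw [map_smul]
    generalize X.D.coact b = p
    induction p with
    | zero => simp
    | add a b ha hb => simp only [smul_add, tmul_add, map_add, ha, hb]
    | tmul p1 p2 => simp [TensorProduct.smul_tmul'])

/-- The right unitor. -/
def rightIso (X : ComodPair k) : tensorPair X unitPair ≅ X :=
  mkIso (X := tensorPair X unitPair) (Coalgebra.TensorProduct.rid k k X.C)
    (TensorProduct.rid k X.D.carrier) (by
    intro y
    refine LinearMap.congr_fun (f := X.D.coact ∘ₗ (TensorProduct.rid k X.D.carrier).toLinearMap)
      (g := TensorProduct.map _ _ ∘ₗ (tensorPair X unitPair).D.coact) ?_ y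
    apply TensorProduct.ext'
    intro b a
    change X.D.coact (a • b) = TensorProduct.map (TensorProduct.rid k _).toLinearMap
      (TensorProduct.rid k _).toLinearMap
      (TensorProduct.tensorTensorTensorComm k _ _ _ _
        (X.D.coact b ⊗ₜ Coalgebra.comul (R := k) (A := k) a))
    rw [map_smul]
    generalize X.D.coact b = p
    induction p with
    | zero => simp
    | add a b ha hb => simp only [smul_add, add_tmul, map_add, ha, hb]
    | tmul p1 p2 => simp [TensorProduct.smul_tmul'])

instance : MonoidalCategoryStruct (ComodPair k) where
  tensorObj := tensorPair
  tensorUnit := unitPair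
  tensorHom := tensorPairHom
  whiskerLeft X _ _ F := tensorPairHom (𝟙 X) F
  whiskerRight F X := tensorPairHom F (𝟙 X)
  associator := assocIso
  leftUnitor := leftIso
  rightUnitor := rightIso

instance : MonoidalCategory (ComodPair k) :=
  MonoidalCategory.ofTensorHom
    (id_tensorHom_id := fun _ _ => hom_ext (TensorProduct.ext' fun _ _ => rfl)
      (TensorProduct.ext' fun _ _ => rfl))
    (id_tensorHom := fun _ _ _ _ => rfl)
    (tensorHom_id := fun _ _ => rfl)
    (tensorHom_comp_tensorHom := fun _ _ _ _ => hom_ext (TensorProduct.ext' fun _ _ => rfl)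
      (TensorProduct.ext' fun _ _ => rfl))
    (associator_naturality := fun _ _ _ => hom_ext
      (TensorProduct.ext_threefold fun _ _ _ => rfl)
      (TensorProduct.ext_threefold fun _ _ _ => rfl))
    (leftUnitor_naturality := fun F => hom_ext
      (TensorProduct.ext' fun a x => (F.f.toLinearMap.map_smul a x).symm)
      (TensorProduct.ext' fun a x => (F.g.map_smul a x).symm))
    (rightUnitor_naturality := fun F => hom_ext
      (TensorProduct.ext' fun x a => (F.f.toLinearMap.map_smul a x).symm)
      (TensorProduct.ext' fun x a => (F.g.map_smul a x).symm))
    (pentagon := fun _ _ _ _ => hom_ext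
      (TensorProduct.ext_fourfold fun _ _ _ _ => rfl)
      (TensorProduct.ext_fourfold fun _ _ _ _ => rfl))
    (triangle := fun _ _ => hom_ext
      (TensorProduct.ext_threefold fun x a y =>
        (TensorProduct.smul_tmul (R := k) (show k from a) x y).symm)
      (TensorProduct.ext_threefold fun x a y =>
        (TensorProduct.smul_tmul (R := k) (show k from a) x y).symm))

/-- The symmetry. -/
def swapHom (X Y : ComodPair k) : tensorPair X Y ⟶ tensorPair Y X :=
  ⟨{ (TensorProduct.comm k X.C Y.C).toLinearMap with
      counit_comp := TensorProduct.ext' fun x y => by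
        change Coalgebra.counit (R := k) x * Coalgebra.counit (R := k) y =
          Coalgebra.counit (R := k) y * Coalgebra.counit (R := k) x
        exact mul_comm _ _
      map_comp_comul := by
        apply TensorProduct.ext'
        intro x y
        change TensorProduct.map (TensorProduct.comm k X.C Y.C).toLinearMap
          (TensorProduct.comm k X.C Y.C).toLinearMap
          (TensorProduct.tensorTensorTensorComm k _ _ _ _
            (Coalgebra.comul (R := k) x ⊗ₜ Coalgebra.comul (R := k) y)) =
          TensorProduct.tensorTensorTensorComm k _ _ _ _
            (Coalgebra.comul (R := k) y ⊗ₜ Coalgebra.comul (R := k) x)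
        generalize Coalgebra.comul (R := k) x = p
        generalize Coalgebra.comul (R := k) y = q
        induction p with
        | zero => simp
        | add a b ha hb => simp only [add_tmul, tmul_add, map_add, ha, hb]
        | tmul p1 p2 =>
          induction q with
          | zero => simp
          | add a b ha hb => simp only [add_tmul, tmul_add, map_add, ha, hb]
          | tmul q1 q2 => rfl },
    (TensorProduct.comm k X.D.carrier Y.D.carrier).toLinearMap, by
    apply TensorProduct.ext'
    intro x y
    change TensorProduct.tensorTensorTensorComm k _ _ _ _ (Y.D.coact y ⊗ₜ X.D.coact x) =
      TensorProduct.map (TensorProduct.comm k _ _).toLinearMap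
          (TensorProduct.comm k _ _).toLinearMap
        (TensorProduct.tensorTensorTensorComm k _ _ _ _ (X.D.coact x ⊗ₜ Y.D.coact y))
    generalize X.D.coact x = p
    generalize Y.D.coact y = q
    induction p with
    | zero => simp
    | add a b ha hb => simp only [add_tmul, tmul_add, map_add, ha, hb]
    | tmul p1 p2 =>
      induction q with
      | zero => simp
      | add a b ha hb => simp only [add_tmul, tmul_add, map_add, ha, hb]
      | tmul q1 q2 => rfl⟩

instance : SymmetricCategory (ComodPair k) where
  braiding X Y :=
    { hom := swapHom X Y
      inv := swapHom Y X
      hom_inv_id := hom_ext (TensorProduct.ext' fun _ _ => rfl) (TensorProduct.ext' fun _ _ => rfl)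
      inv_hom_id := hom_ext (TensorProduct.ext' fun _ _ => rfl)
        (TensorProduct.ext' fun _ _ => rfl) }
  braiding_naturality_right _ _ _ _ :=
    hom_ext (TensorProduct.ext' fun _ _ => rfl) (TensorProduct.ext' fun _ _ => rfl)
  braiding_naturality_left _ _ :=
    hom_ext (TensorProduct.ext' fun _ _ => rfl) (TensorProduct.ext' fun _ _ => rfl)
  hexagon_forward _ _ _ := hom_ext
    (TensorProduct.ext_threefold fun _ _ _ => rfl) (TensorProduct.ext_threefold fun _ _ _ => rfl)
  hexagon_reverse X Y Z := hom_ext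
    (by
      apply TensorProduct.ext
      ext x : 1
      apply TensorProduct.ext'
      intro y z
      rfl)
    (by
      apply TensorProduct.ext
      ext x : 1
      apply TensorProduct.ext'
      intro y z
      rfl)
  symmetry _ _ :=
    hom_ext (TensorProduct.ext' fun _ _ => rfl) (TensorProduct.ext' fun _ _ => rfl)

end ComodPair
/-! ### Hopf algebroids -/

/-- An `(s, t)`-ring over `A`: a `k`-algebra `U` with algebra maps `s : A → U` and
`t : Aᵒᵖ → U` whose images commute. -/
structure STRing (k : Type u) [Field k] : Type (u + 1) where
  U : Type u
  A : Type u
  [ringU : Ring U]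
  [algebraU : Algebra k U]
  [ringA : Ring A]
  [algebraA : Algebra k A]
  s : A →ₐ[k] U
  t : Aᵐᵒᵖ →ₐ[k] U
  s_t_comm : ∀ a b : A, s a * t (op b) = t (op b) * s a

attribute [instance] STRing.ringU STRing.algebraU STRing.ringA STRing.algebraA

namespace STRing

variable {k : Type u} [Field k] (B : STRing k)
variable {N : Type u} [AddCommGroup N] [Module k N] (l : B.A → N →ₗ[k] N)

/-- The subspace of `U ⊗ₖ N` spanned by `u ◁ a ⊗ n - u ⊗ a n`, where `u ◁ a = t(a) u` and `l` is
the left action of `A` on `N`. -/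
def rel : Submodule k (B.U ⊗[k] N) :=
  Submodule.span k {z | ∃ a u n, z = (B.t (op a) * u) ⊗ₜ n - u ⊗ₜ l a n}

/-- The balanced tensor product `U_◁ ⊗_A N` over the noncommutative ring `A`, where `N` is a left
`A`-module with action `l`. -/
abbrev Tens : Type u := (B.U ⊗[k] N) ⧸ B.rel l

/-- The projection `U ⊗ₖ N → U_◁ ⊗_A N`. -/
def proj : B.U ⊗[k] N →ₗ[k] B.Tens l := (B.rel l).mkQ

theorem proj_rel (a : B.A) (u : B.U) (n : N) :
    B.proj l ((B.t (op a) * u) ⊗ₜ n) = B.proj l (u ⊗ₜ l a n) := by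
  rw [← sub_eq_zero, ← map_sub]
  exact (Submodule.Quotient.mk_eq_zero _).2 (Submodule.subset_span ⟨a, u, n, rfl⟩)

/-- The left action `a ▷ u = s(a) u` of `A` on `U`. -/
def leftU (a : B.A) : B.U →ₗ[k] B.U := LinearMap.mulLeft k (B.s a)

/-- `U ⊗_A U = U_◁ ⊗_A ▷U`. -/
abbrev TensU : Type u := B.Tens B.leftU

/-- The projection `U ⊗ₖ U → U ⊗_A U`. -/
abbrev projU : B.U ⊗[k] B.U →ₗ[k] B.TensU := B.proj B.leftU

/-- The left action `a (u ⊗ n) = s(a) u ⊗ n` of `A` on `U_◁ ⊗_A N`. -/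
def leftTens (a : B.A) : B.Tens l →ₗ[k] B.Tens l :=
  (B.rel l).mapQ (B.rel l) ((B.leftU a).rTensor N) (by
    refine Submodule.span_le.2 ?_
    rintro _ ⟨b, u, n, rfl⟩
    refine Submodule.subset_span ⟨b, B.s a * u, n, ?_⟩
    simp only [map_sub, LinearMap.rTensor_tmul, leftU, LinearMap.mulLeft_apply]
    rw [← mul_assoc, B.s_t_comm, mul_assoc])

/-- The right action `(u ⊗ v) a = u ⊗ t(a) v` of `A` on `U ⊗_A U`. -/
def rightTensU (a : B.A) : B.TensU →ₗ[k] B.TensU :=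
  (B.rel B.leftU).mapQ (B.rel B.leftU) ((LinearMap.mulLeft k (B.t (op a))).lTensor B.U) (by
    refine Submodule.span_le.2 ?_
    rintro _ ⟨b, u, n, rfl⟩
    refine Submodule.subset_span ⟨b, u, B.t (op a) * n, ?_⟩
    simp only [map_sub, LinearMap.lTensor_tmul, leftU, LinearMap.mulLeft_apply]
    rw [← mul_assoc (B.t (op a)), ← B.s_t_comm, mul_assoc])

/-- The right multiplication `(u ⊗ v) · (x ⊗ y) = u x ⊗ v y` of `U ⊗_A U` by `U ⊗ₖ U`. -/
def mulTens : B.TensU →ₗ[k] (B.U ⊗[k] B.U) →ₗ[k] B.TensU :=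
  (B.rel B.leftU).liftQ ((LinearMap.mul k (B.U ⊗[k] B.U)).compr₂ B.projU) (by
    refine Submodule.span_le.2 ?_
    rintro _ ⟨a, u, v, rfl⟩
    refine LinearMap.mem_ker.2 (TensorProduct.ext' fun x y => ?_)
    rw [map_sub]
    change B.projU (((B.t (op a) * u) ⊗ₜ v) * (x ⊗ₜ y)) -
      B.projU ((u ⊗ₜ (B.s a * v)) * (x ⊗ₜ y)) = 0
    rw [Algebra.TensorProduct.tmul_mul_tmul, Algebra.TensorProduct.tmul_mul_tmul, mul_assoc,
      mul_assoc]
    exact sub_eq_zero.2 (B.proj_rel B.leftU a (u * x) (v * y)))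

/-- The map `U ⊗ₖ N → U ⊗_A (U ⊗_A N)`, `u ⊗ n ↦ u ⊗ δ(n)`, for `δ : N → U ⊗_A N`. -/
def idTensor (δ : N →ₗ[k] B.Tens l) : B.U ⊗[k] N →ₗ[k] B.Tens (B.leftTens l) :=
  B.proj (B.leftTens l) ∘ₗ δ.lTensor B.U

/-- The map `(U ⊗_A U) × N → U ⊗_A (U ⊗_A N)`, `(u ⊗ v, n) ↦ u ⊗ (v ⊗ n)`. -/
def assocMap : B.TensU →ₗ[k] N →ₗ[k] B.Tens (B.leftTens l) :=
  (B.rel B.leftU).liftQ (TensorProduct.curry (B.proj (B.leftTens l) ∘ₗ (B.proj l).lTensor B.U ∘ₗ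
    (TensorProduct.assoc k B.U B.U N).toLinearMap)) (by
    refine Submodule.span_le.2 ?_
    rintro _ ⟨a, u, v, rfl⟩
    refine LinearMap.mem_ker.2 (LinearMap.ext fun n => ?_)
    simp only [map_sub, LinearMap.sub_apply, TensorProduct.curry_apply, LinearMap.comp_apply,
      LinearEquiv.coe_coe, TensorProduct.assoc_tmul, LinearMap.lTensor_tmul, proj_rel,
      LinearMap.zero_apply, sub_eq_zero]
    rfl)

/-- The map `U ⊗ₖ N → U ⊗_A (U ⊗_A N)`, `u ⊗ n ↦ Δ(u) ⊗ n`, for `Δ : U → U ⊗_A U`. -/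
def tensorId (Δ : B.U →ₗ[k] B.TensU) : B.U ⊗[k] N →ₗ[k] B.Tens (B.leftTens l) :=
  TensorProduct.lift (B.assocMap l ∘ₗ Δ)

end STRing

/-- A left bialgebroid. In the axioms, `projU (∑ i, x i ⊗ₜ y i) = Δ u` says that `∑ xᵢ ⊗ yᵢ` is an
expression `u₍₁₎ ⊗ u₍₂₎` in Sweedler notation; the formulas do not depend on its choice. -/
structure LeftBialgebroid (k : Type u) [Field k] : Type (u + 1) extends STRing k where
  Δ : U →ₗ[k] toSTRing.TensU
  ε : U →ₗ[k] A
  /-- `Δ` and `ε` are maps of `(A, A)`-bimodules. -/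
  Δ_left : ∀ a u, Δ (s a * u) = toSTRing.leftTens _ a (Δ u)
  Δ_right : ∀ a u, Δ (t (op a) * u) = toSTRing.rightTensU a (Δ u)
  ε_left : ∀ a u, ε (s a * u) = a * ε u
  ε_right : ∀ a u, ε (t (op a) * u) = ε u * a
  /-- `(Δ ⊗ id) Δ = (id ⊗ Δ) Δ`. -/
  coassoc : ∀ (u : U) (z : U ⊗[k] U), toSTRing.projU z = Δ u →
    toSTRing.tensorId toSTRing.leftU Δ z = toSTRing.idTensor toSTRing.leftU Δ z
  /-- `ε(u₍₁₎) ▷ u₍₂₎ = u`. -/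
  counit_left : ∀ (u : U) (n : ℕ) (x y : Fin n → U), toSTRing.projU (∑ i, x i ⊗ₜ y i) = Δ u →
    ∑ i, s (ε (x i)) * y i = u
  /-- `u₍₁₎ ◁ ε(u₍₂₎) = u`. -/
  counit_right : ∀ (u : U) (n : ℕ) (x y : Fin n → U), toSTRing.projU (∑ i, x i ⊗ₜ y i) = Δ u →
    ∑ i, t (op (ε (y i))) * x i = u
  /-- `Δ` takes values in the Takeuchi product: `u₍₁₎ t(a) ⊗ u₍₂₎ = u₍₁₎ ⊗ u₍₂₎ s(a)`. -/
  Δ_takeuchi : ∀ u a, toSTRing.mulTens (Δ u) (t (op a) ⊗ₜ 1) = toSTRing.mulTens (Δ u) (1 ⊗ₜ s a)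
  /-- `Δ` is a map of unital algebras into the Takeuchi product. -/
  Δ_one : Δ 1 = toSTRing.projU (1 ⊗ₜ 1)
  Δ_mul : ∀ (u v : U) (z : U ⊗[k] U), toSTRing.projU z = Δ v →
    Δ (u * v) = toSTRing.mulTens (Δ u) z
  ε_mul_s : ∀ u v, ε (u * s (ε v)) = ε (u * v)
  ε_mul_t : ∀ u v, ε (u * t (op (ε v))) = ε (u * v)

/-- A Hopf algebroid: a left bialgebroid with an involutive antipode. -/
structure HopfAlgebroid (k : Type u) [Field k] : Type (u + 1) extends LeftBialgebroid k where
  S : U →ₗ[k] U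
  S_one : S 1 = 1
  S_mul : ∀ u v, S (u * v) = S v * S u
  S_S : ∀ u, S (S u) = u
  S_t : ∀ a, S (t (op a)) = s a
  /-- `S(u₍₁₎)₍₁₎ u₍₂₎ ⊗ S(u₍₁₎)₍₂₎ = 1 ⊗ S(u)`. -/
  antipode_left : ∀ (u : U) (n : ℕ) (x y : Fin n → U), toSTRing.projU (∑ i, x i ⊗ₜ y i) = Δ u →
    ∑ i, toSTRing.mulTens (Δ (S (x i))) (y i ⊗ₜ 1) = toSTRing.projU (1 ⊗ₜ S u)
  /-- `S(u₍₂₎)₍₁₎ ⊗ S(u₍₂₎)₍₂₎ u₍₁₎ = S(u) ⊗ 1`. -/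
  antipode_right : ∀ (u : U) (n : ℕ) (x y : Fin n → U), toSTRing.projU (∑ i, x i ⊗ₜ y i) = Δ u →
    ∑ i, toSTRing.mulTens (Δ (S (y i))) (1 ⊗ₜ x i) = toSTRing.projU (S u ⊗ₜ 1)

/-- The Hopf-Galois map `u ⊗ v ↦ u₍₁₎ ⊗_A u₍₂₎ v`, as a map on `U ⊗ₖ U`. It factors through
`▶U ⊗_{Aᵒᵖ} U_◁`, the quotient by the span of all `u t(a) ⊗ v - u ⊗ t(a) v`. -/
def HopfAlgebroid.galois {k : Type u} [Field k] (H : HopfAlgebroid k) :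
    H.U ⊗[k] H.U →ₗ[k] H.TensU :=
  TensorProduct.lift (H.mulTens.compl₁₂ H.Δ (TensorProduct.mk k H.U H.U 1))

/-! ### Stable anti-Yetter-Drinfeld modules -/

open scoped RightActions in
/-- A stable anti-Yetter-Drinfeld module over `H`. It is a right `U`-module and a left comodule
over the coring `U`, hence a left `A`-module `P` with a coaction `P → U_◁ ⊗_A P`. -/
structure SAYDModule {k : Type u} [Field k] (H : HopfAlgebroid k) : Type (u + 1) where
  P : Type u
  [addCommGroup : AddCommGroup P]
  [module : Module k P]
  [moduleU : Module H.Uᵐᵒᵖ P]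
  [scalarTowerU : IsScalarTower k H.Uᵐᵒᵖ P]
  [moduleA : Module H.A P]
  [scalarTowerA : IsScalarTower k H.A P]
  coact : P →ₗ[k] H.Tens (N := P) (fun a => Algebra.lsmul k k P a)
  /-- The coaction is left `A`-linear, coassociative and counital. -/
  coact_left : ∀ (a : H.A) (p : P), coact (a • p) = H.leftTens _ a (coact p)
  coassoc : ∀ (p : P) (z : H.U ⊗[k] P), H.proj _ z = coact p →
    H.tensorId _ H.Δ z = H.idTensor _ coact z
  counit : ∀ (p : P) (n : ℕ) (q : Fin n → H.U) (r : Fin n → P),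
    H.proj _ (∑ i, q i ⊗ₜ r i) = coact p → ∑ i, H.ε (q i) • r i = p
  /-- The two `Aᵉ`-module structures agree:
  `p s(a) t(b) = b ε(p₍₋₁₎ s(a)) p₍₀₎`. -/
  act_eq : ∀ (a b : H.A) (p : P) (n : ℕ) (q : Fin n → H.U) (r : Fin n → P),
    H.proj _ (∑ i, q i ⊗ₜ r i) = coact p →
      (p <• H.s a) <• H.t (op b) = b • ∑ i, H.ε (q i * H.s a) • r i
  /-- The anti-Yetter-Drinfeld condition `Δ(p u) = u₋ p₍₋₁₎ u₊₍₁₎ ⊗_A p₍₀₎ u₊₍₂₎`, where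
  `u₊ ⊗ u₋` is the preimage of `u ⊗ 1` under the Hopf-Galois map and
  `u₊₍₁₎ ⊗ u₊₍₂₎ ⊗ u₋` is taken in its standard form `u₍₁₎ ⊗ u₍₂₎₊ ⊗ u₍₂₎₋`.
  Here `∑ xᵢ ⊗ yᵢ = u₍₁₎ ⊗ u₍₂₎`, `∑ⱼ vᵢⱼ ⊗ wᵢⱼ = yᵢ₊ ⊗ yᵢ₋` and `∑ qₗ ⊗ rₗ = p₍₋₁₎ ⊗ p₍₀₎`. -/
  antiYD : ∀ (p : P) (u : H.U)
    (n : ℕ) (x y : Fin n → H.U), H.projU (∑ i, x i ⊗ₜ y i) = H.Δ u →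
    ∀ (m : ℕ) (v w : Fin n → Fin m → H.U),
      (∀ i, H.galois (∑ j, v i j ⊗ₜ w i j) = H.projU (y i ⊗ₜ 1)) →
    ∀ (h : ℕ) (q : Fin h → H.U) (r : Fin h → P), H.proj _ (∑ l, q l ⊗ₜ r l) = coact p →
      coact (p <• u) = H.proj _ (∑ i, ∑ j, ∑ l, (w i j * q l * x i) ⊗ₜ (r l <• v i j))
  /-- Stability: `p₍₀₎ p₍₋₁₎ = p`. -/
  stable : ∀ (p : P) (n : ℕ) (q : Fin n → H.U) (r : Fin n → P),
    H.proj _ (∑ i, q i ⊗ₜ r i) = coact p → ∑ i, r i <• q i = p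

attribute [instance] SAYDModule.addCommGroup SAYDModule.module SAYDModule.moduleU
  SAYDModule.scalarTowerU SAYDModule.moduleA SAYDModule.scalarTowerA

/-- The projection `U ⊗ₖ P → U_◁ ⊗_A P`. -/
def SAYDModule.proj {k : Type u} [Field k] {H : HopfAlgebroid k} (P : SAYDModule H) :
    H.U ⊗[k] P.P →ₗ[k] H.Tens (N := P.P) (fun a => Algebra.lsmul k k P.P a) :=
  H.toSTRing.proj _

/-! ### Measurings -/

/-- The map `(c ⊗ d, m ⊗ n) ↦ F(c)(m) ⊗ G(d)(n)`. -/
def diag {k : Type u} [Field k] {C D M N M' N' : Type u} [AddCommGroup C] [Module k C]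
    [AddCommGroup D] [Module k D] [AddCommGroup M] [Module k M]
    [AddCommGroup N] [Module k N] [AddCommGroup M'] [Module k M'] [AddCommGroup N'] [Module k N']
    (F : C →ₗ[k] M →ₗ[k] M') (G : D →ₗ[k] N →ₗ[k] N') :
    C ⊗[k] D →ₗ[k] (M ⊗[k] N) →ₗ[k] (M' ⊗[k] N') :=
  TensorProduct.homTensorHomMap (.id k) M N M' N' ∘ₗ TensorProduct.map F G

section Measuring

variable {k : Type u} [Field k]
variable {C : Type u} [AddCommGroup C] [Module k C] [Coalgebra k C]

/-- A coalgebra measuring between algebras. -/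
structure IsAlgMeasuring {R R' : Type u} [Ring R] [Algebra k R] [Ring R'] [Algebra k R']
    (ψ : C →ₗ[k] R →ₗ[k] R') : Prop where
  /-- `ψ(x)(1) = ε(x) 1`. -/
  map_one : ∀ x, ψ x 1 = Coalgebra.counit (R := k) x • (1 : R')
  /-- `ψ(x)(a b) = ψ(x₍₁₎)(a) ψ(x₍₂₎)(b)`. -/
  map_mul : ∀ x a b, ψ x (a * b) = LinearMap.mul' k R'
    (TensorProduct.map (ψ.flip a) (ψ.flip b) (Coalgebra.comul (R := k) x))

/-- A measuring `(Ψ, ψ)` of Hopf algebroids. -/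
structure IsMeasuring (H H' : HopfAlgebroid k)
    (Ψ : C →ₗ[k] H.U →ₗ[k] H'.U) (ψ : C →ₗ[k] H.A →ₗ[k] H'.A) : Prop where
  measU : IsAlgMeasuring Ψ
  measA : IsAlgMeasuring ψ
  map_s : ∀ x a, Ψ x (H.s a) = H'.s (ψ x a)
  map_t : ∀ x a, Ψ x (H.t (op a)) = H'.t (op (ψ x a))
  map_S : ∀ x u, Ψ x (H.S u) = H'.S (Ψ x u)
  map_ε : ∀ x u, ψ x (H.ε u) = H'.ε (Ψ x u)
  /-- `Δ'(Ψ(x)(u)) = Ψ(x₍₁₎)(u₍₁₎) ⊗ Ψ(x₍₂₎)(u₍₂₎)`. -/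
  map_Δ : ∀ x u (z : H.U ⊗[k] H.U), H.projU z = H.Δ u →
    H'.Δ (Ψ x u) = H'.projU (diag Ψ Ψ (Coalgebra.comul (R := k) x) z)

open scoped RightActions in
/-- A `(C, Ψ, ψ)`-comodule measuring `Ω : D → Hom(P, P')`. -/
structure IsComoduleMeasuring {H H' : HopfAlgebroid k} (P : SAYDModule H) (P' : SAYDModule H')
    (Ψ : C →ₗ[k] H.U →ₗ[k] H'.U) (ψ : C →ₗ[k] H.A →ₗ[k] H'.A)
    (D : RightComodule k C) (Ω : D.carrier →ₗ[k] P.P →ₗ[k] P'.P) : Prop where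
  measuring : IsMeasuring H H' Ψ ψ
  /-- `Ω(y)(p u) = Ω(y₍₀₎)(p) Ψ(y₍₁₎)(u)`. -/
  map_act : ∀ y p u (n : ℕ) (d : Fin n → D.carrier) (c : Fin n → C),
    ∑ i, d i ⊗ₜ c i = D.coact y → Ω y (p <• u) = ∑ i, Ω (d i) p <• Ψ (c i) u
  /-- `Δ'(Ω(y)(p)) = Ψ(y₍₁₎)(p₍₋₁₎) ⊗ Ω(y₍₀₎)(p₍₀₎)`. -/
  map_coact : ∀ y p (z : H.U ⊗[k] P.P), P.proj z = P.coact p →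
    P'.coact (Ω y p) = P'.proj (diag Ψ Ω (TensorProduct.comm k _ _ (D.coact y)) z)

end Measuring

/-! ### Universal measurings -/

/-- A universal cocommutative measuring coalgebra `M_c(H, H')`, with its measuring `(Φ, φ)`. -/
structure UniversalMeasuring {k : Type u} [Field k] (H H' : HopfAlgebroid k) : Type (u + 1) where
  C : Type u
  [addCommGroup : AddCommGroup C]
  [module : Module k C]
  [coalgebra : Coalgebra k C]
  [isCocomm : Coalgebra.IsCocomm k C]
  Φ : C →ₗ[k] H.U →ₗ[k] H'.U
  φ : C →ₗ[k] H.A →ₗ[k] H'.A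
  measuring : IsMeasuring H H' Φ φ
  universal : ∀ (E : Type u) [AddCommGroup E] [Module k E] [Coalgebra k E]
    [Coalgebra.IsCocomm k E] (Ψ : E →ₗ[k] H.U →ₗ[k] H'.U) (ψ : E →ₗ[k] H.A →ₗ[k] H'.A),
    IsMeasuring H H' Ψ ψ → ∃! ξ : E →ₗc[k] C, (∀ x, Φ (ξ x) = Ψ x) ∧ ∀ x, φ (ξ x) = ψ x

attribute [instance] UniversalMeasuring.addCommGroup UniversalMeasuring.module
  UniversalMeasuring.coalgebra UniversalMeasuring.isCocomm

namespace RightComodule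

variable {k C : Type u} [Field k] [AddCommGroup C] [Module k C] [Coalgebra k C]

/-- A linear map is a map of right `C`-comodules. -/
def IsHom (D E : RightComodule k C) (g : D.carrier →ₗ[k] E.carrier) : Prop :=
  E.coact ∘ₗ g = g.rTensor C ∘ₗ D.coact

variable (C) (V : Type u) [AddCommGroup V] [Module k V]

/-- The cofree right `C`-comodule `V ⊗ C` on `V`, with coaction `id ⊗ Δ`. -/
def cofree : RightComodule k C where
  carrier := V ⊗[k] C
  coact := (TensorProduct.assoc k V C C).symm.toLinearMap ∘ₗ
    (Coalgebra.comul (R := k) (A := C)).lTensor V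
  coassoc := by
    apply TensorProduct.ext'
    intro v c
    have h1 : ∀ w : C ⊗[k] C, TensorProduct.assoc k (V ⊗[k] C) C C
        (((TensorProduct.assoc k V C C).symm.toLinearMap ∘ₗ
          (Coalgebra.comul (R := k) (A := C)).lTensor V).rTensor C
          ((TensorProduct.assoc k V C C).symm (v ⊗ₜ w))) =
        (TensorProduct.assoc k V C (C ⊗[k] C)).symm
          (v ⊗ₜ TensorProduct.assoc k C C C (Coalgebra.comul.rTensor C w)) := by
      intro w
      induction w with
      | zero => simp
      | add a b ha hb => simp only [tmul_add, map_add, ha, hb]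
      | tmul a b =>
        simp only [TensorProduct.assoc_symm_tmul, LinearMap.rTensor_tmul, LinearMap.comp_apply,
          LinearMap.lTensor_tmul, LinearEquiv.coe_coe]
        generalize Coalgebra.comul (R := k) a = p
        induction p with
        | zero => simp
        | add a b ha hb => simp only [add_tmul, tmul_add, map_add, ha, hb]
        | tmul p q => rfl
    have h2 : ∀ w : C ⊗[k] C, (Coalgebra.comul (R := k) (A := C)).lTensor (V ⊗[k] C)
          ((TensorProduct.assoc k V C C).symm (v ⊗ₜ w)) =
        (TensorProduct.assoc k V C (C ⊗[k] C)).symm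
          (v ⊗ₜ (Coalgebra.comul.lTensor C w)) := by
      intro w
      induction w with
      | zero => simp
      | add a b ha hb => simp only [tmul_add, map_add, ha, hb]
      | tmul a b => rfl
    refine (h1 _).trans ?_
    rw [Coalgebra.coassoc_apply]
    exact (h2 _).symm
  counit := by
    apply TensorProduct.ext'
    intro v c
    have h : ∀ w : C ⊗[k] C, (Coalgebra.counit (R := k) (A := C)).lTensor (V ⊗[k] C)
          ((TensorProduct.assoc k V C C).symm (v ⊗ₜ w)) =
        (TensorProduct.assoc k V C k).symm (v ⊗ₜ (Coalgebra.counit.lTensor C w)) := by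
      intro w
      induction w with
      | zero => simp
      | add a b ha hb => simp only [tmul_add, map_add, ha, hb]
      | tmul a b => rfl
    refine (h _).trans ?_
    rw [Coalgebra.lTensor_counit_comul]
    rfl

/-- The canonical map `id ⊗ ε : V ⊗ C → V` of the cofree comodule. -/
def cofreeEval : (cofree (k := k) C V).carrier →ₗ[k] V :=
  (TensorProduct.rid k V).toLinearMap ∘ₗ (Coalgebra.counit (R := k) (A := C)).lTensor V

/-- Comodule maps into `V ⊗ C` correspond to linear maps into `V`. -/
theorem cofree_universal (D : RightComodule k C) (g : D.carrier →ₗ[k] V) :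
    ∃! χ : D.carrier →ₗ[k] (cofree (k := k) C V).carrier,
      IsHom D (cofree C V) χ ∧ cofreeEval C V ∘ₗ χ = g := by
  let ev : V ⊗[k] C →ₗ[k] V :=
    (TensorProduct.rid k V).toLinearMap ∘ₗ (Coalgebra.counit (R := k) (A := C)).lTensor V
  let co : V ⊗[k] C →ₗ[k] (V ⊗[k] C) ⊗[k] C := (TensorProduct.assoc k V C C).symm.toLinearMap ∘ₗ
    (Coalgebra.comul (R := k) (A := C)).lTensor V
  have key : ∃! χ : D.carrier →ₗ[k] V ⊗[k] C,
      co ∘ₗ χ = χ.rTensor C ∘ₗ D.coact ∧ ev ∘ₗ χ = g := by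
    refine ⟨g.rTensor C ∘ₗ D.coact, ⟨?_, ?_⟩, ?_⟩
    · ext y
      have h1 : ∀ w : D.carrier ⊗[k] C, co (g.rTensor C w) =
          (g.rTensor C).rTensor C ((TensorProduct.assoc k _ _ _).symm
            (Coalgebra.comul.lTensor _ w)) := by
        intro w
        induction w with
        | zero => simp
        | add a b ha hb => simp only [map_add, ha, hb]
        | tmul a b =>
          change (TensorProduct.assoc k V C C).symm (g a ⊗ₜ Coalgebra.comul b) =
            (g.rTensor C).rTensor C ((TensorProduct.assoc k _ _ _).symm (a ⊗ₜ Coalgebra.comul b))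
          generalize Coalgebra.comul (R := k) b = p
          induction p with
          | zero => simp
          | add a b ha hb => simp only [tmul_add, map_add, ha, hb]
          | tmul p q => rfl
      have h2 := LinearMap.congr_fun D.coassoc y
      simp only [LinearMap.comp_apply, LinearEquiv.coe_coe] at h2
      simp only [LinearMap.comp_apply, LinearMap.rTensor_comp]
      rw [h1, ← h2, LinearEquiv.symm_apply_apply]
    · ext y
      have h1 : ∀ w : D.carrier ⊗[k] C, ev (g.rTensor C w) =
          g (TensorProduct.rid k _ (Coalgebra.counit.lTensor _ w)) := by
        intro w
        induction w with
        | zero => simp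
        | add a b ha hb => simp only [map_add, ha, hb]
        | tmul a b => simp [ev]
      have h2 := LinearMap.congr_fun D.counit y
      simp only [LinearMap.comp_apply] at h2 ⊢
      rw [h1, h2]
      simp
    · rintro χ ⟨h, rfl⟩
      ext y
      have h1 : ∀ w : V ⊗[k] C, ev.rTensor C (co w) = w := by
        intro w
        induction w with
        | zero => simp
        | add a b ha hb => simp only [map_add, ha, hb]
        | tmul a b =>
          have h3 : ∀ p : C ⊗[k] C, ev.rTensor C
              ((TensorProduct.assoc k V C C).symm (a ⊗ₜ p)) =
              a ⊗ₜ TensorProduct.lid k C (Coalgebra.counit.rTensor C p) := by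
            intro p
            induction p with
            | zero => simp
            | add a b ha hb => simp only [tmul_add, map_add, ha, hb]
            | tmul p q => simp [ev, TensorProduct.smul_tmul]
          refine (h3 _).trans ?_
          simp
      have h2 := LinearMap.congr_fun h y
      simp only [LinearMap.comp_apply] at h2 ⊢
      rw [LinearMap.rTensor_comp, LinearMap.comp_apply, ← h2, h1]
  exact key

end RightComodule

/-- A universal `(C, Ψ, ψ)`-comodule measuring `Θ : Q_C(P, P') → Hom(P, P')`. -/
structure UniversalComoduleMeasuring {k : Type u} [Field k] {C : Type u} [AddCommGroup C]
    [Module k C] [Coalgebra k C] {H H' : HopfAlgebroid k} (P : SAYDModule H) (P' : SAYDModule H')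
    (Ψ : C →ₗ[k] H.U →ₗ[k] H'.U) (ψ : C →ₗ[k] H.A →ₗ[k] H'.A) : Type (u + 1) where
  Q : RightComodule k C
  Θ : Q.carrier →ₗ[k] P.P →ₗ[k] P'.P
  measuring : IsComoduleMeasuring P P' Ψ ψ Q Θ
  universal : ∀ (D : RightComodule k C) (Ω : D.carrier →ₗ[k] P.P →ₗ[k] P'.P),
    IsComoduleMeasuring P P' Ψ ψ D Ω →
      ∃! χ : D.carrier →ₗ[k] Q.carrier, RightComodule.IsHom D Q χ ∧ Θ ∘ₗ χ = Ω

/-- An object of the global category of SAYD modules: a Hopf algebroid and an SAYD module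
over it. -/
structure SAYDPair (k : Type u) [Field k] : Type (u + 1) where
  H : HopfAlgebroid k
  M : SAYDModule H

section HomObj

variable {k : Type u} [Field k]
  (M : ∀ H H' : HopfAlgebroid k, UniversalMeasuring H H')
  (Q : ∀ X Y : SAYDPair k, UniversalComoduleMeasuring X.M Y.M (M X.H Y.H).Φ (M X.H Y.H).φ)

/-- The hom-object `(M_c(H, H'), Q_{M_c(H, H')}(P, P'))` from `(H, P)` to `(H', P')`. -/
def homObj (X Y : SAYDPair k) : ComodPair k where
  C := (M X.H Y.H).C
  D := (Q X Y).Q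

/-- A map `(k, k) ⟶ homObj X X` is the unit if it names the identities of `U`, `A` and `P`. -/
structure IsUnitMap (X : SAYDPair k) (j : 𝟙_ (ComodPair k) ⟶ homObj M Q X X) : Prop where
  onU : ∀ x : k, (M X.H X.H).Φ (j.f x) = x • LinearMap.id
  onA : ∀ x : k, (M X.H X.H).φ (j.f x) = x • LinearMap.id
  onP : ∀ x : k, (Q X X).Θ (j.g x) = x • LinearMap.id

/-- A map `homObj X Y ⊗ homObj Y Z ⟶ homObj X Z` is the composition if it induces the composition
of linear maps on `U`, `A` and `P`. -/
structure IsCompMap (X Y Z : SAYDPair k)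
    (c : homObj M Q X Y ⊗ homObj M Q Y Z ⟶ homObj M Q X Z) : Prop where
  onU : ∀ (x : (M X.H Y.H).C) (x' : (M Y.H Z.H).C),
    (M X.H Z.H).Φ (c.f (x ⊗ₜ[k] x')) = (M Y.H Z.H).Φ x' ∘ₗ (M X.H Y.H).Φ x
  onA : ∀ (x : (M X.H Y.H).C) (x' : (M Y.H Z.H).C),
    (M X.H Z.H).φ (c.f (x ⊗ₜ[k] x')) = (M Y.H Z.H).φ x' ∘ₗ (M X.H Y.H).φ x
  onP : ∀ (y : (Q X Y).Q.carrier) (y' : (Q Y Z).Q.carrier),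
    (Q X Z).Θ (c.g (y ⊗ₜ[k] y')) = (Q Y Z).Θ y' ∘ₗ (Q X Y).Θ y

end HomObj

end HopfMeasuring

end

open HopfMeasuring

noncomputable section

namespace HopfMeasuring

variable {k : Type u} [Field k]

/-! ### Coideals and separated coalgebras -/

section Coideal

variable {C E W : Type u} [AddCommGroup C] [Module k C] [AddCommGroup E] [Module k E]
  [AddCommGroup W] [Module k W]

/-! Every axiom of a measuring is linear in the element of the coalgebra and stable under pullback
along coalgebra maps. A coalgebra that is spanned by the images of measuring coalgebras is therefore
measuring, and the universal object is the largest one obtained in this way, cut down so that maps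
into it are unique.

For Hopf algebroids put `W = Hom(U, U') × Hom(A, A')`. All cocommutative coalgebra structures on the
spaces `kⁿ`, together with a measuring map to `W`, form a set. Their direct sum maps to `W`, and
dividing by the largest coideal in the kernel gives `M_c`. The map `M_c → W` is separating: its
kernel contains no nonzero coideal. Since the range of a difference of two coalgebra maps is a
coideal, coalgebra maps into `M_c` are determined by their composites with `M_c → W`
(`IsSeparating.hom_ext`).

For existence, let `E` be a cocommutative measuring coalgebra. Every element of `E` lies in a
finite-dimensional subcoalgebra, hence in the image of one of the summands. In the quotient of `E ×
M_c` by the largest coideal killed in `W`, the coalgebra `M_c` embeds and the images of such a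
summand through `E` and through `M_c` coincide. So `E` lands in `M_c` (`Terminal.exists_hom`).

For comodules the cofree comodule `Hom(P, P') ⊗ C` is available. A comodule measuring is the same as
a suitable comodule map into it, and the sum of the images of all of these is a subcomodule that is
again measuring and hence universal (`isComoduleMeasuring_maxComodule`).

For the enrichment, both universal properties combine into one: a pair `Z` with a comodule measuring
on it has exactly one map to the hom-object that induces the given linear maps (`exists_represents`,
`Represents.hom_ext`). The identity maps over `(k, k)` and the composites over a tensor product of
pairs are comodule measurings, which yields units and compositions. The axioms follow by uniqueness
from those for composition of linear maps. -/

theorem map_injective {A B A' B' : Type u} [AddCommGroup A] [Module k A] [AddCommGroup B]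
    [Module k B] [AddCommGroup A'] [Module k A'] [AddCommGroup B'] [Module k B']
    {f : A →ₗ[k] A'} {g : B →ₗ[k] B'} (hf : Function.Injective f) (hg : Function.Injective g) :
    Function.Injective (TensorProduct.map f g) := by
  rw [← LinearMap.lTensor_comp_rTensor, LinearMap.coe_comp]
  exact (Module.Flat.lTensor_preserves_injective_linearMap g hg).comp
    (Module.Flat.rTensor_preserves_injective_linearMap f hf)

/-- With `K = ker f`, the quotient `C ⧸ K` embeds in `E`, and over a field its tensor square embeds
in `E ⊗ E`. There the class of `Δ x` becomes `Δ (f x)`, which is zero. -/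
theorem isCoideal_ker [Coalgebra k C] [Coalgebra k E] (f : C →ₗc[k] E) :
    (LinearMap.ker f.toLinearMap).IsCoideal where
  counit_eq_zero x hx := by
    have h := LinearMap.congr_fun f.counit_comp x
    rw [LinearMap.comp_apply, LinearMap.mem_ker.1 hx, map_zero] at h
    exact h.symm
  map_mkQ_comul_eq_zero x hx := by
    set K := LinearMap.ker f.toLinearMap
    have hj : Function.Injective (K.liftQ f.toLinearMap le_rfl) := by
      rw [← LinearMap.ker_eq_bot, Submodule.ker_liftQ_eq_bot _ _ _ le_rfl]
    apply map_injective hj hj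
    have h := LinearMap.congr_fun f.map_comp_comul x
    rw [LinearMap.comp_apply, LinearMap.comp_apply, LinearMap.mem_ker.1 hx, map_zero] at h
    rw [map_zero, TensorProduct.map_map, Submodule.liftQ_mkQ]
    exact h

/-- The maps `f` and `g` agree after projection modulo the range of `f - g`, and `Δ (f x - g x)` is
`(f ⊗ f - g ⊗ g) (Δ x)`, so it vanishes there. -/
theorem isCoideal_range_sub [Coalgebra k C] [Coalgebra k E] (f g : C →ₗc[k] E) :
    (LinearMap.range (f.toLinearMap - g.toLinearMap)).IsCoideal where
  counit_eq_zero := by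
    rintro _ ⟨x, rfl⟩
    have hf := LinearMap.congr_fun f.counit_comp x
    have hg := LinearMap.congr_fun g.counit_comp x
    simp only [LinearMap.comp_apply] at hf hg
    rw [LinearMap.sub_apply, map_sub, hf, hg, sub_self]
  map_mkQ_comul_eq_zero := by
    rintro _ ⟨x, rfl⟩
    have hf := LinearMap.congr_fun f.map_comp_comul x
    have hg := LinearMap.congr_fun g.map_comp_comul x
    simp only [LinearMap.comp_apply] at hf hg
    set J := LinearMap.range (f.toLinearMap - g.toLinearMap)
    have h : J.mkQ ∘ₗ f.toLinearMap = J.mkQ ∘ₗ g.toLinearMap := by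
      ext y
      exact (Submodule.Quotient.eq J).2 ⟨y, rfl⟩
    rw [LinearMap.sub_apply, map_sub, map_sub, ← hf, ← hg, TensorProduct.map_map,
      TensorProduct.map_map, h, sub_self]

/-- The sum of all coideals on which `Φ` vanishes. -/
def maxCoideal [Coalgebra k C] (Φ : C →ₗ[k] W) : Submodule k C :=
  sSup {J | J.IsCoideal ∧ J ≤ LinearMap.ker Φ}

theorem maxCoideal_le_ker [Coalgebra k C] (Φ : C →ₗ[k] W) : maxCoideal Φ ≤ LinearMap.ker Φ :=
  sSup_le fun _ h => h.2

instance [Coalgebra k C] (Φ : C →ₗ[k] W) : (maxCoideal Φ).IsCoideal where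
  counit_eq_zero := by
    suffices h : maxCoideal Φ ≤ LinearMap.ker (Coalgebra.counit (R := k) (A := C)) from
      fun x hx => h hx
    exact sSup_le fun J hJ x hx => hJ.1.counit_eq_zero hx
  map_mkQ_comul_eq_zero := by
    suffices h : maxCoideal Φ ≤ LinearMap.ker
        (TensorProduct.map (maxCoideal Φ).mkQ (maxCoideal Φ).mkQ ∘ₗ
          Coalgebra.comul (R := k) (A := C)) from fun x hx => h hx
    -- The projection to the quotient by the sum factors through the quotient by each coideal `J`,
    -- where `Δ x` already vanishes.
    refine sSup_le fun J hJ x hx => ?_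
    have hle : J ≤ maxCoideal Φ := le_sSup hJ
    have h : (maxCoideal Φ).mkQ = Submodule.factor hle ∘ₗ J.mkQ := rfl
    rw [LinearMap.mem_ker, LinearMap.comp_apply, h, ← TensorProduct.map_map,
      hJ.1.map_mkQ_comul_eq_zero hx, map_zero]

/-- A linear map out of a coalgebra is separating if its kernel contains no nonzero coideal. -/
def IsSeparating [Coalgebra k C] (Φ : C →ₗ[k] W) : Prop :=
  ∀ J : Submodule k C, J.IsCoideal → J ≤ LinearMap.ker Φ → J = ⊥

/-- The range of `f - g` is a coideal in the kernel of `Φ`. This gives uniqueness in the universal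
property of the measuring coalgebra. -/
theorem IsSeparating.hom_ext [Coalgebra k C] [Coalgebra k E] {Φ : C →ₗ[k] W}
    (hΦ : IsSeparating Φ) {f g : E →ₗc[k] C} (h : ∀ x, Φ (f x) = Φ (g x)) : f = g := by
  have := hΦ _ (isCoideal_range_sub f g) (by
    rintro _ ⟨x, rfl⟩
    exact (map_sub Φ _ _).trans (sub_eq_zero.2 (h x)))
  rw [LinearMap.range_eq_bot, sub_eq_zero] at this
  ext x
  exact LinearMap.congr_fun this x

/-- Since `Φ` factors through `f`, it kills the coideal `ker f`. -/
theorem IsSeparating.injective [Coalgebra k C] [Coalgebra k E] {Φ : C →ₗ[k] W}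
    (hΦ : IsSeparating Φ) (f : C →ₗc[k] E) (Ψ : E →ₗ[k] W) (h : ∀ x, Ψ (f x) = Φ x) :
    Function.Injective f := by
  have := hΦ _ (isCoideal_ker f) (fun x hx => by
    rw [LinearMap.mem_ker, ← h]
    exact (congrArg Ψ hx).trans (map_zero Ψ))
  exact LinearMap.ker_eq_bot.1 this

/-- The map induced by `Φ` on the quotient by the largest coideal in its kernel. -/
def sepMap [Coalgebra k C] (Φ : C →ₗ[k] W) : C ⧸ maxCoideal Φ →ₗ[k] W :=
  (maxCoideal Φ).liftQ Φ (maxCoideal_le_ker Φ)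

theorem isSeparating_sepMap [Coalgebra k C] (Φ : C →ₗ[k] W) : IsSeparating (sepMap Φ) := by
  intro J hJ hle
  -- The preimage of `J` in `C` is the kernel of a coalgebra map, hence a coideal killed by `Φ`, and
  -- so it is contained in the largest one.
  have hK : LinearMap.ker ((Coalgebra.Quotient.mkQCoalgHom J).comp
      (Coalgebra.Quotient.mkQCoalgHom (maxCoideal Φ))).toLinearMap ≤ maxCoideal Φ := by
    refine le_sSup ⟨isCoideal_ker _, fun x hx => ?_⟩
    exact hle ((Submodule.Quotient.mk_eq_zero J).1 hx)
  rw [eq_bot_iff]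
  intro y hy
  obtain ⟨x, rfl⟩ := Submodule.Quotient.mk_surjective _ y
  exact (Submodule.Quotient.mk_eq_zero _).2 (hK ((Submodule.Quotient.mk_eq_zero J).2 hy))

instance [Coalgebra k C] [Coalgebra.IsCocomm k C] (J : Submodule k C) [J.IsCoideal] :
    Coalgebra.IsCocomm k (C ⧸ J) where
  comm_comp_comul := by
    ext x
    have h : ∀ z : C ⊗[k] C, TensorProduct.comm k _ _ (TensorProduct.map J.mkQ J.mkQ z) =
        TensorProduct.map J.mkQ J.mkQ (TensorProduct.comm k _ _ z) := fun z =>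
      (TensorProduct.map_comm _ _ _).symm
    refine (h _).trans ?_
    rw [Coalgebra.comm_comul]
    rfl

end Coideal

/-! ### Local finiteness of cocommutative coalgebras -/

section Finite

variable {M N E : Type u} [AddCommGroup M] [Module k M] [AddCommGroup N] [Module k N]
  [AddCommGroup E] [Module k E]

/-- The slice `m ⊗ n ↦ f(n) m`. -/
def slice (f : N →ₗ[k] k) : M ⊗[k] N →ₗ[k] M :=
  (TensorProduct.rid k M).toLinearMap ∘ₗ f.lTensor M

theorem slice_tmul (f : N →ₗ[k] k) (m : M) (n : N) : slice f (m ⊗ₜ[k] n) = f n • m := by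
  simp [slice]

/-- The coordinates of a tensor with respect to a basis of `N` are its slices by the coordinate
functionals. -/
theorem eq_zero_of_slice (x : M ⊗[k] N) (h : ∀ f : N →ₗ[k] k, slice f x = 0) : x = 0 := by
  classical
  let b := Module.Basis.ofVectorSpace k N
  have hx : ∀ (y : M ⊗[k] N) i, TensorProduct.equivFinsuppOfBasisRight b y i =
      slice (b.coord i) y := by
    intro y i
    induction y with
    | zero => simp
    | add y z hy hz => simp only [map_add, Finsupp.add_apply, hy, hz]
    | tmul m n => simp [slice_tmul]
  apply (TensorProduct.equivFinsuppOfBasisRight (M := M) b).injective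
  ext i
  rw [map_zero, Finsupp.zero_apply, hx, h]

/-- The space of all slices of `x : M ⊗ N`. -/
def slices (x : M ⊗[k] N) : Submodule k M :=
  Submodule.span k (Set.range fun f : N →ₗ[k] k => slice f x)

theorem slice_mem_slices (x : M ⊗[k] N) (f : N →ₗ[k] k) : slice f x ∈ slices x :=
  Submodule.subset_span ⟨f, rfl⟩

/-- All slices of the image of `x` in `(M ⧸ slices x) ⊗ N` are zero, so this image is zero and
exactness applies. -/
theorem mem_range_rTensor_slices (x : M ⊗[k] N) :
    x ∈ LinearMap.range ((slices x).subtype.rTensor N) := by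
  have hex := rTensor_exact N (LinearMap.exact_subtype_mkQ (slices x))
    (slices x).mkQ_surjective
  refine (hex x).1 (eq_zero_of_slice _ fun f => ?_)
  have h : ∀ y : M ⊗[k] N, slice f ((slices x).mkQ.rTensor N y) = (slices x).mkQ (slice f y) := by
    intro y
    induction y with
    | zero => simp
    | add y z hy hz => simp only [map_add, hy, hz]
    | tmul m n => simp [slice_tmul]
  rw [h]
  exact (Submodule.Quotient.mk_eq_zero _).2 (slice_mem_slices x f)

instance finite_slices (x : M ⊗[k] N) : Module.Finite k (slices x) := by
  obtain ⟨s, rfl⟩ := TensorProduct.exists_finset x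
  have : FiniteDimensional k (Submodule.span k (Prod.fst '' (s : Set (M × N)))) :=
    FiniteDimensional.span_of_finite k (s.finite_toSet.image _)
  refine Submodule.finiteDimensional_of_le (S₂ := Submodule.span k (Prod.fst '' (s : Set (M × N))))
    (Submodule.span_le.2 ?_)
  rintro _ ⟨f, rfl⟩
  simp only [map_sum, slice_tmul]
  exact Submodule.sum_mem _ fun p hp => Submodule.smul_mem _ _
    (Submodule.subset_span ⟨p, hp, rfl⟩)

/-- This is `(D ⊗ N) ∩ (M ⊗ D') = D ⊗ D'`. A lift of `x` to `D ⊗ N` dies in `D ⊗ (N ⧸ D')`, because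
that space embeds in `M ⊗ (N ⧸ D')`. -/
theorem mem_range_map_subtype {D : Submodule k M} {D' : Submodule k N} {x : M ⊗[k] N}
    (h₁ : x ∈ LinearMap.range (D.subtype.rTensor N))
    (h₂ : x ∈ LinearMap.range (D'.subtype.lTensor M)) :
    x ∈ LinearMap.range (TensorProduct.map D.subtype D'.subtype) := by
  obtain ⟨y, rfl⟩ := h₁
  have hex := lTensor_exact M (LinearMap.exact_subtype_mkQ D') D'.mkQ_surjective
  have h := (hex _).2 h₂
  rw [← LinearMap.comp_apply, LinearMap.lTensor_comp_rTensor, ← LinearMap.rTensor_comp_lTensor,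
    LinearMap.comp_apply] at h
  have h' : D'.mkQ.lTensor D y = 0 :=
    Module.Flat.rTensor_preserves_injective_linearMap _ D.injective_subtype
      (h.trans (map_zero _).symm)
  obtain ⟨z, rfl⟩ := (lTensor_exact D (LinearMap.exact_subtype_mkQ D') D'.mkQ_surjective y).1 h'
  refine ⟨z, ?_⟩
  rw [← LinearMap.comp_apply, LinearMap.rTensor_comp_lTensor]

/-! ### Finite-dimensional subcoalgebras -/

variable [Coalgebra k E]

/-- Coassociativity: `f(e₍₂₎) Δ(e₍₁₎) = e₍₁₎ ⊗ f(e₍₃₎) e₍₂₎`. Only the second leg changes, so the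
first leg of `Δ` of a slice stays in the space of slices. -/
theorem comul_slice (f : E →ₗ[k] k) (e : E) :
    Coalgebra.comul (R := k) (slice f (Coalgebra.comul (R := k) e)) =
      (slice f ∘ₗ Coalgebra.comul (R := k)).lTensor E (Coalgebra.comul (R := k) e) := by
  have h₁ : ∀ z : E ⊗[k] E, Coalgebra.comul (R := k) (slice f z) =
      (slice f).lTensor E (TensorProduct.assoc k E E E
        ((Coalgebra.comul (R := k) (A := E)).rTensor E z)) := by
    intro z
    induction z with
    | zero => simp
    | add x y hx hy => simp only [map_add, hx, hy]
    | tmul x y =>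
      rw [slice_tmul, map_smul, LinearMap.rTensor_tmul]
      generalize Coalgebra.comul (R := k) x = w
      induction w with
      | zero => simp
      | add a b ha hb => simp only [smul_add, add_tmul, map_add, ha, hb]
      | tmul a b => simp [slice_tmul]
  rw [h₁, Coalgebra.coassoc_apply, ← LinearMap.comp_apply, ← LinearMap.lTensor_comp]

/-- Every element of a cocommutative coalgebra lies in a finite-dimensional subcoalgebra. -/
theorem exists_finite_subcoalgebra [Coalgebra.IsCocomm k E] (e : E) :
    ∃ D : Submodule k E, Module.Finite k D ∧ e ∈ D ∧
      ∀ d ∈ D, Coalgebra.comul (R := k) d ∈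
        LinearMap.range (TensorProduct.map D.subtype D.subtype) := by
  let x := Coalgebra.comul (R := k) e
  refine ⟨slices x, inferInstance, ?_, fun d hd => ?_⟩
  -- By counitality `e` is the slice of `Δ e` by the counit.
  · have h := slice_mem_slices x (Coalgebra.counit (R := k))
    rwa [slice, LinearMap.comp_apply, Coalgebra.lTensor_counit_comul, LinearEquiv.coe_coe,
      TensorProduct.rid_tmul, one_smul] at h
  · have key : Coalgebra.comul (R := k) d ∈ LinearMap.range ((slices x).subtype.rTensor E) := by
      suffices h : slices x ≤ (LinearMap.range ((slices x).subtype.rTensor E)).comap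
          (Coalgebra.comul (R := k)) from h hd
      refine Submodule.span_le.2 ?_
      rintro _ ⟨f, rfl⟩
      change Coalgebra.comul (R := k) (slice f (Coalgebra.comul (R := k) e)) ∈
        LinearMap.range ((slices x).subtype.rTensor E)
      rw [comul_slice]
      obtain ⟨y, hy⟩ := mem_range_rTensor_slices x
      refine ⟨(slice f ∘ₗ Coalgebra.comul (R := k)).lTensor _ y, ?_⟩
      rw [← LinearMap.comp_apply, LinearMap.rTensor_comp_lTensor,
        ← LinearMap.lTensor_comp_rTensor, LinearMap.comp_apply, hy]
    -- Cocommutativity turns the containment in `slices x ⊗ E` into one in `E ⊗ slices x`.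
    refine mem_range_map_subtype key ?_
    obtain ⟨y, hy⟩ := key
    refine ⟨TensorProduct.comm k _ _ y, ?_⟩
    rw [← Coalgebra.comm_comul k d, ← hy]
    exact (TensorProduct.map_comm _ _ _)

/-- A coalgebra structure on `V`, given by an injection into a coalgebra through which the
comultiplication factors. -/
abbrev coalgebraOfInjective {V : Type u} [AddCommGroup V] [Module k V] (i : V →ₗ[k] E)
    (hi : Function.Injective i) (δ : V →ₗ[k] V ⊗[k] V)
    (hδ : ∀ v, TensorProduct.map i i (δ v) = Coalgebra.comul (R := k) (i v)) : Coalgebra k V where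
  comul := δ
  counit := Coalgebra.counit (R := k) ∘ₗ i
  coassoc := by
    ext v
    -- Each coalgebra axiom for `V` is checked after embedding by `i` into the corresponding axiom
    -- for `E`.
    apply map_injective hi (map_injective hi hi)
    have h₁ : ∀ z : V ⊗[k] V, TensorProduct.map i (TensorProduct.map i i)
        (TensorProduct.assoc k V V V (δ.rTensor V z)) = TensorProduct.assoc k E E E
        ((Coalgebra.comul (R := k) (A := E)).rTensor E (TensorProduct.map i i z)) := by
      intro z
      induction z with
      | zero => simp
      | add x y hx hy => simp only [map_add, hx, hy]
      | tmul x y =>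
        rw [TensorProduct.map_tmul, LinearMap.rTensor_tmul, LinearMap.rTensor_tmul, ← hδ]
        generalize δ x = w
        induction w with
        | zero => simp
        | add x y hx hy => simp only [add_tmul, map_add, hx, hy]
        | tmul x y => rfl
    have h₂ : ∀ z : V ⊗[k] V, TensorProduct.map i (TensorProduct.map i i)
        (δ.lTensor V z) =
        (Coalgebra.comul (R := k) (A := E)).lTensor E (TensorProduct.map i i z) := by
      intro z
      induction z with
      | zero => simp
      | add x y hx hy => simp only [map_add, hx, hy]
      | tmul x y => simp [hδ]
    simp only [LinearMap.comp_apply, LinearEquiv.coe_coe]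
    rw [h₁, h₂, hδ, Coalgebra.coassoc_apply]
  rTensor_counit_comp_comul := by
    ext v
    apply map_injective (f := LinearMap.id) Function.injective_id hi
    have h : ∀ z : V ⊗[k] V, TensorProduct.map LinearMap.id i
        ((Coalgebra.counit (R := k) ∘ₗ i).rTensor V z) =
        (Coalgebra.counit (R := k) (A := E)).rTensor E (TensorProduct.map i i z) := by
      intro z
      induction z with
      | zero => simp
      | add x y hx hy => simp only [map_add, hx, hy]
      | tmul x y => simp
    simp only [LinearMap.comp_apply]
    rw [h, hδ, Coalgebra.rTensor_counit_comul]
    rfl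
  lTensor_counit_comp_comul := by
    ext v
    apply map_injective (g := LinearMap.id) hi Function.injective_id
    have h : ∀ z : V ⊗[k] V, TensorProduct.map i LinearMap.id
        ((Coalgebra.counit (R := k) ∘ₗ i).lTensor V z) =
        (Coalgebra.counit (R := k) (A := E)).lTensor E (TensorProduct.map i i z) := by
      intro z
      induction z with
      | zero => simp
      | add x y hx hy => simp only [map_add, hx, hy]
      | tmul x y => simp
    simp only [LinearMap.comp_apply]
    rw [h, hδ, Coalgebra.lTensor_counit_comul]
    rfl

theorem exists_lift_of_injective {X Y Z : Type u} [AddCommGroup X] [Module k X] [AddCommGroup Y]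
    [Module k Y] [AddCommGroup Z] [Module k Z] {j : Y →ₗ[k] Z} (hj : Function.Injective j)
    (g : X →ₗ[k] Z) (h : ∀ x, g x ∈ LinearMap.range j) : ∃ δ : X →ₗ[k] Y, ∀ x, j (δ x) = g x :=
  ⟨(LinearEquiv.ofInjective j hj).symm.toLinearMap ∘ₗ g.codRestrict _ h, fun x =>
    congrArg Subtype.val ((LinearEquiv.ofInjective j hj).apply_symm_apply ⟨g x, h x⟩)⟩

/-- `kⁿ`, without its standard coalgebra structure. -/
def Vec (k : Type u) (n : ℕ) : Type u := Fin n → k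

instance (n : ℕ) : AddCommGroup (Vec k n) := inferInstanceAs (AddCommGroup (Fin n → k))

instance (n : ℕ) : Module k (Vec k n) := inferInstanceAs (Module k (Fin n → k))

/-- A basis transports the coalgebra structure of a finite-dimensional subcoalgebra containing `e`
to some `kⁿ`. With these fixed carriers the coalgebras to be summed form a type in the universe `u`.
-/
theorem exists_vec_hom [Coalgebra.IsCocomm k E] (e : E) :
    ∃ (n : ℕ) (_ : Coalgebra k (Vec k n)) (_ : Coalgebra.IsCocomm k (Vec k n))
      (f : Vec k n →ₗc[k] E), e ∈ LinearMap.range f.toLinearMap := by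
  obtain ⟨D, hD, heD, hcomul⟩ := exists_finite_subcoalgebra (k := k) e
  let b := Module.finBasis k D
  let i : Vec k (Module.finrank k D) →ₗ[k] E := D.subtype ∘ₗ b.equivFun.symm.toLinearMap
  have hi : Function.Injective i := D.injective_subtype.comp b.equivFun.symm.injective
  obtain ⟨δ, hδ⟩ := exists_lift_of_injective (map_injective hi hi)
    (Coalgebra.comul (R := k) ∘ₗ i) (fun v => by
      obtain ⟨z, hz⟩ := hcomul (i v) (b.equivFun.symm v).2
      refine ⟨TensorProduct.map b.equivFun.toLinearMap b.equivFun.toLinearMap z, ?_⟩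
      have h : i ∘ₗ b.equivFun.toLinearMap = D.subtype := by
        ext x
        change ((b.equivFun.symm (b.equivFun x) : D) : E) = x
        rw [LinearEquiv.symm_apply_apply]
      rw [LinearMap.comp_apply, ← hz]
      refine (TensorProduct.map_map _ _ _ _ _).trans ?_
      rw [h])
  let _ := coalgebraOfInjective i hi δ hδ
  refine ⟨_, inferInstance, ⟨?_⟩, ⟨i, rfl, LinearMap.ext hδ⟩, b.equivFun ⟨e, heD⟩, ?_⟩
  · ext v
    apply map_injective hi hi
    refine (TensorProduct.map_comm _ _ _).trans ?_
    change TensorProduct.comm k E E (TensorProduct.map i i (δ v)) = TensorProduct.map i i (δ v)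
    rw [hδ]
    exact Coalgebra.comm_comul k _
  · change ((b.equivFun.symm (b.equivFun _) : D) : E) = e
    rw [LinearEquiv.symm_apply_apply]

end Finite

/-! ### Terminal objects among coalgebras over a vector space -/

/-- The inclusion of a summand of a direct sum of coalgebras, as a coalgebra map. -/
def dfinsuppSingle {ι : Type u} [DecidableEq ι] (A : ι → Type u) [∀ i, AddCommGroup (A i)]
    [∀ i, Module k (A i)] [∀ i, Coalgebra k (A i)] (i : ι) : A i →ₗc[k] Π₀ i, A i :=
  { DFinsupp.lsingle i with
    counit_comp := DFinsupp.counit_comp_lsingle k ι A i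
    map_comp_comul := (DFinsupp.comul_comp_lsingle k ι A i).symm }

section Terminal

variable (k) (W : Type u) [AddCommGroup W] [Module k W]

/-- A cocommutative coalgebra structure on some `kⁿ` with a linear map to `W`. -/
structure VecCoalg : Type u where
  n : ℕ
  [coalgebra : Coalgebra k (Vec k n)]
  [isCocomm : Coalgebra.IsCocomm k (Vec k n)]
  map : Vec k n →ₗ[k] W

variable {k W}

/-- The underlying space of a `VecCoalg`. -/
abbrev VecCoalg.Carrier (i : VecCoalg k W) : Type u := Vec k i.n

attribute [instance] VecCoalg.coalgebra VecCoalg.isCocomm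

variable (p : VecCoalg k W → Prop)

/-- The direct sum of all finite-dimensional coalgebras over `W` that satisfy `p`. -/
abbrev SumCoalg : Type u := Π₀ i : {i : VecCoalg k W // p i}, i.1.Carrier

open Classical in
instance : Coalgebra k (SumCoalg p) := DFinsupp.instCoalgebra _ _ _

open Classical in
instance : Coalgebra.IsCocomm k (SumCoalg p) := DFinsupp.instIsCocomm _ _ _

open Classical in
/-- The inclusion of a summand, as a coalgebra map. -/
def sumSingle (i : {i : VecCoalg k W // p i}) : i.1.Carrier →ₗc[k] SumCoalg p :=
  dfinsuppSingle (fun i : {i : VecCoalg k W // p i} => i.1.Carrier) i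

open Classical in
/-- The map from the direct sum to `W`. -/
def sumMap : SumCoalg p →ₗ[k] W := DFinsupp.lsum k fun i => i.1.map

/-- The quotient of the direct sum of all finite-dimensional coalgebras over `W` that satisfy `p`
by the largest coideal that vanishes in `W`. -/
abbrev Terminal : Type u := SumCoalg p ⧸ maxCoideal (sumMap p)

/-- The canonical coalgebra map to the terminal object. -/
def toTerminal (i : VecCoalg k W) (hi : p i) : i.Carrier →ₗc[k] Terminal p :=
  (Coalgebra.Quotient.mkQCoalgHom (maxCoideal (sumMap p))).comp (sumSingle p ⟨i, hi⟩)

theorem sepMap_toTerminal (i : VecCoalg k W) (hi : p i) (x : i.Carrier) :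
    sepMap (sumMap p) (toTerminal p i hi x) = i.map x := by
  classical
  exact DFinsupp.lsum_single k (fun i : {i : VecCoalg k W // p i} => i.1.map) ⟨i, hi⟩ x

/-- The summands generate the direct sum, which maps onto its quotient. Axioms linear in the
coalgebra thus pass from the summands to the terminal object. -/
theorem Terminal.induction {q : Terminal p → Prop} (h0 : q 0)
    (hadd : ∀ x y, q x → q y → q (x + y)) (h : ∀ i hi x, q (toTerminal p i hi x)) :
    ∀ x, q x := by
  classical
  intro x
  obtain ⟨x, rfl⟩ := Submodule.Quotient.mk_surjective _ x
  induction x using DFinsupp.induction with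
  | h0 => exact h0
  | ha i b f _ _ hf => exact hadd _ _ (h i.1 i.2 b) hf

/-- Separation makes `f` injective, so `g` lifts to a linear map. It respects comultiplication
because `f ⊗ f` is injective too. -/
theorem exists_hom_of_range_le {W M P E : Type u} [AddCommGroup W] [Module k W]
    [AddCommGroup M] [Module k M] [Coalgebra k M]
    [AddCommGroup P] [Module k P] [Coalgebra k P] [AddCommGroup E] [Module k E] [Coalgebra k E]
    {Φ : M →ₗ[k] W} (hΦ : IsSeparating Φ) (Θ : P →ₗ[k] W)
    (f : M →ₗc[k] P) (hf : ∀ x, Θ (f x) = Φ x) (g : E →ₗc[k] P)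
    (h : ∀ e, g e ∈ LinearMap.range f.toLinearMap) :
    ∃ ξ : E →ₗc[k] M, ∀ x, f (ξ x) = g x := by
  have hinj : Function.Injective f.toLinearMap := hΦ.injective f Θ hf
  obtain ⟨ξ, hξ⟩ := exists_lift_of_injective hinj g.toLinearMap h
  have hξ' : f.toLinearMap ∘ₗ ξ = g.toLinearMap := LinearMap.ext hξ
  refine ⟨⟨ξ, ?_, ?_⟩, hξ⟩
  · rw [← f.counit_comp, LinearMap.comp_assoc, hξ', g.counit_comp]
  · ext x
    apply map_injective hinj hinj
    simp only [LinearMap.comp_apply]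
    rw [TensorProduct.map_map, hξ']
    have h₁ := LinearMap.congr_fun f.map_comp_comul (ξ x)
    have h₂ := LinearMap.congr_fun g.map_comp_comul x
    simp only [LinearMap.comp_apply] at h₁ h₂
    rw [h₁, h₂]
    exact congrArg _ (hξ x).symm

theorem Terminal.exists_hom_vec (n : ℕ) [Coalgebra k (Vec k n)] [Coalgebra.IsCocomm k (Vec k n)]
    (g : Vec k n →ₗ[k] W) (hg : p ⟨n, g⟩) :
    ∃ t : Vec k n →ₗc[k] Terminal p, ∀ x, sepMap (sumMap p) (t x) = g x :=
  ⟨toTerminal p ⟨n, g⟩ hg, sepMap_toTerminal p ⟨n, g⟩ hg⟩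

/-- `E` and the terminal object are compared inside a common separated coalgebra, the quotient of
their direct sum by the largest coideal that vanishes in `W`. The image of `E` there lies in that of
the terminal object. -/
theorem Terminal.exists_hom {E : Type u} [AddCommGroup E] [Module k E] [Coalgebra k E]
    [Coalgebra.IsCocomm k E] (Ψ : E →ₗ[k] W)
    (hΨ : ∀ (n : ℕ) [Coalgebra k (Vec k n)] [Coalgebra.IsCocomm k (Vec k n)]
      (f : Vec k n →ₗc[k] E), p ⟨n, Ψ ∘ₗ f.toLinearMap⟩) :
    ∃ ξ : E →ₗc[k] Terminal p, ∀ x, sepMap (sumMap p) (ξ x) = Ψ x := by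
  let Φ := sepMap (sumMap p)
  let Θ : E × Terminal p →ₗ[k] W := Ψ.coprod Φ
  let l : E →ₗc[k] (E × Terminal p) ⧸ maxCoideal Θ :=
    (Coalgebra.Quotient.mkQCoalgHom (maxCoideal Θ)).comp
      ⟨LinearMap.inl k E _, Prod.counit_comp_inl _ _ _, (Prod.comul_comp_inl _ _ _).symm⟩
  let r : Terminal p →ₗc[k] (E × Terminal p) ⧸ maxCoideal Θ :=
    (Coalgebra.Quotient.mkQCoalgHom (maxCoideal Θ)).comp
      ⟨LinearMap.inr k E _, Prod.counit_comp_inr _ _ _, (Prod.comul_comp_inr _ _ _).symm⟩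
  have hl : ∀ x, sepMap Θ (l x) = Ψ x := fun x => by
    change Ψ x + Φ 0 = Ψ x
    rw [map_zero, add_zero]
  have hr : ∀ x, sepMap Θ (r x) = Φ x := fun x => by
    change Ψ 0 + Φ x = Φ x
    rw [map_zero, zero_add]
  obtain ⟨ξ, hξ⟩ := exists_hom_of_range_le (isSeparating_sepMap (sumMap p)) (sepMap Θ) r hr l
    (fun e => by
      obtain ⟨n, _, _, f, y, rfl⟩ := exists_vec_hom (k := k) e
      obtain ⟨t, ht⟩ := Terminal.exists_hom_vec p n (Ψ ∘ₗ f.toLinearMap) (hΨ n f)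
      -- Both routes from `kⁿ` to the separated quotient induce the same map to `W`, so they are
      -- equal.
      have h : l.comp f = r.comp t := (isSeparating_sepMap Θ).hom_ext fun x => by
        change sepMap Θ (l (f x)) = sepMap Θ (r (t x))
        rw [hl, hr, ht]
        rfl
      exact ⟨t y, (congrArg (fun F => F y) h).symm⟩)
  refine ⟨ξ, fun x => ?_⟩
  rw [← hl, ← hξ, hr]

end Terminal

/-! ### Operations on measurings of Hopf algebroids -/

section Diag

variable {C D C' D' M N M' N' M'' N'' : Type u} [AddCommGroup C] [Module k C]
  [AddCommGroup D] [Module k D] [AddCommGroup C'] [Module k C'] [AddCommGroup D'] [Module k D']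
  [AddCommGroup M] [Module k M] [AddCommGroup N] [Module k N] [AddCommGroup M'] [Module k M']
  [AddCommGroup N'] [Module k N'] [AddCommGroup M''] [Module k M''] [AddCommGroup N'']
  [Module k N'']

/-- The map `x ⊗ x' ↦ F'(x') ∘ F(x)`. -/
def compMap (F : C →ₗ[k] M →ₗ[k] M') (F' : C' →ₗ[k] M' →ₗ[k] M'') :
    C ⊗[k] C' →ₗ[k] M →ₗ[k] M'' :=
  TensorProduct.lift ((LinearMap.llcomp k M M' M'').flip.compl₁₂ F F')

theorem compMap_tmul (F : C →ₗ[k] M →ₗ[k] M') (F' : C' →ₗ[k] M' →ₗ[k] M'') (x : C) (x' : C') :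
    compMap F F' (x ⊗ₜ x') = F' x' ∘ₗ F x := rfl

theorem diag_tmul (F : C →ₗ[k] M →ₗ[k] M') (G : D →ₗ[k] N →ₗ[k] N') (c : C) (d : D) :
    diag F G (c ⊗ₜ d) = TensorProduct.map (F c) (G d) := rfl

theorem diag_comp (F : C →ₗ[k] M →ₗ[k] M') (G : D →ₗ[k] N →ₗ[k] N') (f : C' →ₗ[k] C)
    (g : D' →ₗ[k] D) (w : C' ⊗[k] D') :
    diag (F ∘ₗ f) (G ∘ₗ g) w = diag F G (TensorProduct.map f g w) := by
  induction w with
  | zero => simp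
  | add x y hx hy => simp only [map_add, hx, hy]
  | tmul x y => rfl

/-- The interchange law `(F' ∘ F) ⊗ (G' ∘ G) = (F' ⊗ G') ∘ (F ⊗ G)`. The shuffle is the one in the
comultiplication of `C ⊗ C'` and in the tensor coaction, so composites are compatible with both. -/
theorem diag_compMap (F : C →ₗ[k] M →ₗ[k] M') (G : D →ₗ[k] N →ₗ[k] N')
    (F' : C' →ₗ[k] M' →ₗ[k] M'') (G' : D' →ₗ[k] N' →ₗ[k] N'') (w : C ⊗[k] D) (w' : C' ⊗[k] D')
    (z : M ⊗[k] N) :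
    diag (compMap F F') (compMap G G')
      (TensorProduct.tensorTensorTensorComm k C D C' D' (w ⊗ₜ w')) z =
    diag F' G' w' (diag F G w z) := by
  induction w with
  | zero => simp
  | add x y hx hy => simp only [add_tmul, map_add, LinearMap.add_apply, hx, hy]
  | tmul x y =>
    induction w' with
    | zero => simp
    | add x' y' hx hy => simp only [tmul_add, map_add, LinearMap.add_apply, hx, hy]
    | tmul x' y' =>
      rw [TensorProduct.tensorTensorTensorComm_tmul, diag_tmul, diag_tmul, diag_tmul,
        compMap_tmul, compMap_tmul, TensorProduct.map_comp]
      rfl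

end Diag

section Measuring

variable {C E C' : Type u} [AddCommGroup C] [Module k C] [Coalgebra k C]
  [AddCommGroup E] [Module k E] [Coalgebra k E] [AddCommGroup C'] [Module k C'] [Coalgebra k C']

theorem comul_tmul_eq (x : C) (x' : C') : Coalgebra.comul (R := k) (x ⊗ₜ[k] x') =
    TensorProduct.tensorTensorTensorComm k C C C' C'
      (Coalgebra.comul (R := k) x ⊗ₜ Coalgebra.comul (R := k) x') := rfl

theorem CoalgHom.map_comul (f : E →ₗc[k] C) (x : E) : Coalgebra.comul (R := k) (f x) =
    TensorProduct.map f.toLinearMap f.toLinearMap (Coalgebra.comul (R := k) x) :=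
  (LinearMap.congr_fun f.map_comp_comul x).symm

/-! ### Measurings of algebras -/

section Algebra

variable {R R' R'' : Type u} [Ring R] [Algebra k R] [Ring R'] [Algebra k R']
  [Ring R''] [Algebra k R'']

theorem IsAlgMeasuring.comp {ψ : C →ₗ[k] R →ₗ[k] R'} (h : IsAlgMeasuring ψ) (f : E →ₗc[k] C) :
    IsAlgMeasuring (ψ ∘ₗ f.toLinearMap) where
  map_one x := (h.map_one (f x)).trans (by
    rw [show Coalgebra.counit (R := k) (f x) = Coalgebra.counit (R := k) x from
      LinearMap.congr_fun f.counit_comp x])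
  map_mul x a b := (h.map_mul (f x) a b).trans (by
    rw [CoalgHom.map_comul, TensorProduct.map_map]
    rfl)

theorem isAlgMeasuring_id : IsAlgMeasuring (LinearMap.toSpanSingleton k (R →ₗ[k] R) LinearMap.id)
    where
  map_one x := rfl
  map_mul x a b := by simp

theorem IsAlgMeasuring.compMap {ψ : C →ₗ[k] R →ₗ[k] R'} (h : IsAlgMeasuring ψ)
    {ψ' : C' →ₗ[k] R' →ₗ[k] R''} (h' : IsAlgMeasuring ψ') :
    IsAlgMeasuring (compMap ψ ψ') where
  map_one x := by
    induction x with
    | zero => simp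
    | add x y hx hy => simp only [map_add, LinearMap.add_apply, add_smul, hx, hy]
    | tmul x x' =>
      rw [compMap_tmul, LinearMap.comp_apply, h.map_one, map_smul, h'.map_one, smul_smul, mul_comm]
      rfl
  map_mul x a b := by
    induction x with
    | zero => simp
    | add x y hx hy => simp only [map_add, LinearMap.add_apply, hx, hy]
    | tmul x x' =>
      rw [compMap_tmul, LinearMap.comp_apply, h.map_mul, comul_tmul_eq]
      generalize Coalgebra.comul (R := k) x = w
      induction w with
      | zero => simp
      | add y z hy hz => simp only [add_tmul, map_add, hy, hz]
      | tmul y z =>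
        rw [TensorProduct.map_tmul, LinearMap.mul'_apply, h'.map_mul]
        generalize Coalgebra.comul (R := k) x' = w'
        induction w' with
        | zero => simp
        | add y z hy hz => simp only [tmul_add, map_add, hy, hz]
        | tmul y z => rfl

/-- Measurings can be checked after pulling back along jointly surjective coalgebra maps. -/
theorem isAlgMeasuring_of_induction {ψ : C →ₗ[k] R →ₗ[k] R'}
    (h : ∀ q : C → Prop, q 0 → (∀ x y, q x → q y → q (x + y)) →
      (∀ (E : Type u) [AddCommGroup E] [Module k E] [Coalgebra k E] (f : E →ₗc[k] C),
        IsAlgMeasuring (ψ ∘ₗ f.toLinearMap) → ∀ y, q (f y)) → ∀ x, q x) :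
    IsAlgMeasuring ψ where
  map_one := by
    refine h _ (by simp) (fun x y hx hy => ?_) (fun E _ _ _ f hf y => ?_)
    · simp only [map_add, LinearMap.add_apply, add_smul, hx, hy]
    · rw [show Coalgebra.counit (R := k) (f y) = Coalgebra.counit (R := k) y from
        LinearMap.congr_fun f.counit_comp y]
      exact hf.map_one y
  map_mul := by
    refine h _ (by simp) (fun x y hx hy a b => ?_) (fun E _ _ _ f hf y a b => ?_)
    · simp only [map_add, LinearMap.add_apply, hx, hy]
    · rw [CoalgHom.map_comul, TensorProduct.map_map]
      exact hf.map_mul y a b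

end Algebra

/-! ### Measurings of Hopf algebroids -/

variable {H H' H'' : HopfAlgebroid k}

theorem IsMeasuring.comp {Ψ : C →ₗ[k] H.U →ₗ[k] H'.U} {ψ : C →ₗ[k] H.A →ₗ[k] H'.A}
    (h : IsMeasuring H H' Ψ ψ) (f : E →ₗc[k] C) :
    IsMeasuring H H' (Ψ ∘ₗ f.toLinearMap) (ψ ∘ₗ f.toLinearMap) where
  measU := h.measU.comp f
  measA := h.measA.comp f
  map_s x := h.map_s (f x)
  map_t x := h.map_t (f x)
  map_S x := h.map_S (f x)
  map_ε x := h.map_ε (f x)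
  map_Δ x u z hz := (h.map_Δ (f x) u z hz).trans (by
    rw [CoalgHom.map_comul, diag_comp])

/-- Each axiom is additive in `x`. At `x = f y` it is the axiom of the pulled-back measuring at `y`,
since `Δ (f y) = (f ⊗ f) (Δ y)`. The hypothesis `h` says that such elements generate `C` additively.
-/
theorem isMeasuring_of_induction {Ψ : C →ₗ[k] H.U →ₗ[k] H'.U} {ψ : C →ₗ[k] H.A →ₗ[k] H'.A}
    (h : ∀ q : C → Prop, q 0 → (∀ x y, q x → q y → q (x + y)) →
      (∀ (E : Type u) [AddCommGroup E] [Module k E] [Coalgebra k E] (f : E →ₗc[k] C),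
        IsMeasuring H H' (Ψ ∘ₗ f.toLinearMap) (ψ ∘ₗ f.toLinearMap) → ∀ y, q (f y)) → ∀ x, q x) :
    IsMeasuring H H' Ψ ψ where
  measU := isAlgMeasuring_of_induction fun q h0 ha hq =>
    h q h0 ha fun E _ _ _ f hf => hq E f hf.measU
  measA := isAlgMeasuring_of_induction fun q h0 ha hq =>
    h q h0 ha fun E _ _ _ f hf => hq E f hf.measA
  map_s := h _ (by simp) (fun x y hx hy a => by simp only [map_add, LinearMap.add_apply, hx, hy])
    fun E _ _ _ f hf => hf.map_s
  map_t := h _ (by simp) (fun x y hx hy a => by simp only [map_add, LinearMap.add_apply, hx, hy,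
    MulOpposite.op_add]) fun E _ _ _ f hf => hf.map_t
  map_S := h _ (by simp) (fun x y hx hy a => by simp only [map_add, LinearMap.add_apply, hx, hy])
    fun E _ _ _ f hf => hf.map_S
  map_ε := h _ (by simp) (fun x y hx hy a => by simp only [map_add, LinearMap.add_apply, hx, hy])
    fun E _ _ _ f hf => hf.map_ε
  map_Δ := by
    refine h _ (by simp) (fun x y hx hy u z hz => ?_) fun E _ _ _ f hf x u z hz => ?_
    · simp only [map_add, LinearMap.add_apply, hx u z hz, hy u z hz]
    · rw [CoalgHom.map_comul, ← diag_comp]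
      exact hf.map_Δ x u z hz

theorem isMeasuring_id (H : HopfAlgebroid k) : IsMeasuring H H
    (LinearMap.toSpanSingleton k (H.U →ₗ[k] H.U) LinearMap.id)
    (LinearMap.toSpanSingleton k (H.A →ₗ[k] H.A) LinearMap.id) where
  measU := isAlgMeasuring_id
  measA := isAlgMeasuring_id
  map_s x a := by simp
  map_t x a := by simp
  map_S x u := by simp
  map_ε x u := by simp
  map_Δ x u z hz := by
    simp [diag_tmul, TensorProduct.map_smul_right, hz]

theorem IsMeasuring.compMap {Ψ : C →ₗ[k] H.U →ₗ[k] H'.U} {ψ : C →ₗ[k] H.A →ₗ[k] H'.A}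
    (h : IsMeasuring H H' Ψ ψ) {Ψ' : C' →ₗ[k] H'.U →ₗ[k] H''.U}
    {ψ' : C' →ₗ[k] H'.A →ₗ[k] H''.A} (h' : IsMeasuring H' H'' Ψ' ψ') :
    IsMeasuring H H'' (compMap Ψ Ψ') (compMap ψ ψ') where
  measU := h.measU.compMap h'.measU
  measA := h.measA.compMap h'.measA
  map_s x a := by
    induction x with
    | zero => simp
    | add x y hx hy => simp only [map_add, LinearMap.add_apply, hx, hy]
    | tmul x x' => simp only [compMap_tmul, LinearMap.comp_apply, h.map_s, h'.map_s]
  map_t x a := by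
    induction x with
    | zero => simp
    | add x y hx hy => simp only [map_add, LinearMap.add_apply, hx, hy, MulOpposite.op_add]
    | tmul x x' => simp only [compMap_tmul, LinearMap.comp_apply, h.map_t, h'.map_t]
  map_S x u := by
    induction x with
    | zero => simp
    | add x y hx hy => simp only [map_add, LinearMap.add_apply, hx, hy]
    | tmul x x' => simp only [compMap_tmul, LinearMap.comp_apply, h.map_S, h'.map_S]
  map_ε x u := by
    induction x with
    | zero => simp
    | add x y hx hy => simp only [map_add, LinearMap.add_apply, hx, hy]
    | tmul x x' => simp only [compMap_tmul, LinearMap.comp_apply, h.map_ε, h'.map_ε]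
  map_Δ x u z hz := by
    induction x with
    | zero => simp
    | add x y hx hy => simp only [map_add, LinearMap.add_apply, hx, hy]
    | tmul x x' =>
      rw [compMap_tmul, LinearMap.comp_apply, comul_tmul_eq, diag_compMap]
      -- The first measuring produces a representative of `Δ' (Ψ x u)`, and the second accepts any
      -- representative.
      exact h'.map_Δ x' _ _ (h.map_Δ x u z hz).symm

/-- The universal measuring, as the terminal object over `Hom(U, U') × Hom(A, A')`. -/
def universalMeasuring (H H' : HopfAlgebroid k) : UniversalMeasuring H H' :=
  let p : VecCoalg k ((H.U →ₗ[k] H'.U) × (H.A →ₗ[k] H'.A)) → Prop := fun i =>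
    IsMeasuring H H' (LinearMap.fst k _ _ ∘ₗ i.map) (LinearMap.snd k _ _ ∘ₗ i.map)
  { C := Terminal p
    Φ := LinearMap.fst k _ _ ∘ₗ sepMap (sumMap p)
    φ := LinearMap.snd k _ _ ∘ₗ sepMap (sumMap p)
    measuring := isMeasuring_of_induction fun q h0 hadd hq =>
      Terminal.induction p h0 hadd fun i hi x => hq _ (toTerminal p i hi) (by
        have h : sepMap (sumMap p) ∘ₗ (toTerminal p i hi).toLinearMap = i.map :=
          LinearMap.ext (sepMap_toTerminal p i hi)
        rw [LinearMap.comp_assoc, LinearMap.comp_assoc, h]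
        exact hi) x
    universal := fun E _ _ _ _ Ψ ψ h => by
      obtain ⟨ξ, hξ⟩ := Terminal.exists_hom p (Ψ.prod ψ) (fun n _ _ f => h.comp f)
      refine ⟨ξ, ⟨fun x => congrArg Prod.fst (hξ x), fun x => congrArg Prod.snd (hξ x)⟩, ?_⟩
      rintro ξ' ⟨h₁, h₂⟩
      -- Separation refers to the map to the product `W`, so agreement of both components is needed.
      exact (isSeparating_sepMap (sumMap p)).hom_ext fun x =>
        (Prod.ext (h₁ x) (h₂ x)).trans (hξ x).symm }

end Measuring

/-! ### Operations on comodule measurings -/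

/-- The right action of `U` on an SAYD module as a bilinear map. -/
def SAYDModule.actMap {H : HopfAlgebroid k} (P : SAYDModule H) : P.P →ₗ[k] H.U →ₗ[k] P.P :=
  ((Algebra.lsmul k k P.P).toLinearMap ∘ₗ (MulOpposite.opLinearEquiv k).toLinearMap).flip

section ActLift

variable {C E D D' : Type u} [AddCommGroup C] [Module k C] [AddCommGroup E] [Module k E]
  [AddCommGroup D] [Module k D] [AddCommGroup D'] [Module k D']
  {H H' : HopfAlgebroid k} {P : SAYDModule H} {P' : SAYDModule H'}

/-- The map `d ⊗ c ↦ Ω(d)(p) Ψ(c)(u)`. -/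
def actLift (P' : SAYDModule H')
    (Ψ : C →ₗ[k] H.U →ₗ[k] H'.U) (Ω : D →ₗ[k] P.P →ₗ[k] P'.P) (p : P.P) (u : H.U) :
    D ⊗[k] C →ₗ[k] P'.P :=
  TensorProduct.lift (P'.actMap.compl₁₂ (Ω.flip p) (Ψ.flip u))

open scoped RightActions in
theorem actLift_tmul
    (Ψ : C →ₗ[k] H.U →ₗ[k] H'.U) (Ω : D →ₗ[k] P.P →ₗ[k] P'.P) (p : P.P) (u : H.U)
    (d : D) (c : C) : actLift P' Ψ Ω p u (d ⊗ₜ c) = Ω d p <• Ψ c u := rfl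

theorem actLift_map
    (Ψ : C →ₗ[k] H.U →ₗ[k] H'.U) (Ω : D →ₗ[k] P.P →ₗ[k] P'.P) (p : P.P) (u : H.U)
    (g : D' →ₗ[k] D) (f : E →ₗ[k] C) (w : D' ⊗[k] E) :
    actLift P' Ψ Ω p u (TensorProduct.map g f w) = actLift P' (Ψ ∘ₗ f) (Ω ∘ₗ g) p u w := by
  induction w with
  | zero => simp
  | add x y hx hy => simp only [map_add, hx, hy]
  | tmul x y => rfl

end ActLift

section Comodule

variable {C E C' : Type u} [AddCommGroup C] [Module k C] [Coalgebra k C]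
  [AddCommGroup E] [Module k E] [Coalgebra k E] [AddCommGroup C'] [Module k C'] [Coalgebra k C']
variable {H H' H'' : HopfAlgebroid k} {P : SAYDModule H} {P' : SAYDModule H'} {P'' : SAYDModule H''}

variable {Ψ : C →ₗ[k] H.U →ₗ[k] H'.U} {ψ : C →ₗ[k] H.A →ₗ[k] H'.A}

open scoped RightActions in
-- The coaction of `y` has some expression as a finite sum of pure tensors. The resulting form of
-- the axiom is linear in the coaction and free of choices.
theorem IsComoduleMeasuring.map_act_eq {D : RightComodule k C} {Ω : D.carrier →ₗ[k] P.P →ₗ[k] P'.P}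
    (h : IsComoduleMeasuring P P' Ψ ψ D Ω) (y : D.carrier) (p : P.P) (u : H.U) :
    Ω y (p <• u) = actLift P' Ψ Ω p u (D.coact y) := by
  obtain ⟨n, d, c, hw⟩ := TensorProduct.exists_sum_tmul_eq (D.coact y)
  rw [h.map_act y p u n d c hw.symm, hw, map_sum]
  rfl

open scoped RightActions in
theorem IsComoduleMeasuring.of_map_act_eq {D : RightComodule k C}
    {Ω : D.carrier →ₗ[k] P.P →ₗ[k] P'.P} (hm : IsMeasuring H H' Ψ ψ)
    (hact : ∀ y (p : P.P) (u : H.U), Ω y (p <• u) = actLift P' Ψ Ω p u (D.coact y))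
    (hcoact : ∀ y p (z : H.U ⊗[k] P.P), P.proj z = P.coact p →
      P'.coact (Ω y p) = P'.proj (diag Ψ Ω (TensorProduct.comm k _ _ (D.coact y)) z)) :
    IsComoduleMeasuring P P' Ψ ψ D Ω where
  measuring := hm
  map_act y p u n d c hw := by
    rw [hact, ← hw, map_sum]
    rfl
  map_coact := hcoact

/-- A linear map `g` is a morphism of comodules over a coalgebra map `f`. -/
def IsHomOver (D : RightComodule k E) (D' : RightComodule k C) (f : E →ₗc[k] C)
    (g : D.carrier →ₗ[k] D'.carrier) : Prop :=
  ∀ y, D'.coact (g y) = TensorProduct.map g f.toLinearMap (D.coact y)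

theorem IsComoduleMeasuring.comp {D' : RightComodule k C} {Ω : D'.carrier →ₗ[k] P.P →ₗ[k] P'.P}
    (h : IsComoduleMeasuring P P' Ψ ψ D' Ω) {D : RightComodule k E} {f : E →ₗc[k] C}
    {g : D.carrier →ₗ[k] D'.carrier} (hg : IsHomOver D D' f g) :
    IsComoduleMeasuring P P' (Ψ ∘ₗ f.toLinearMap) (ψ ∘ₗ f.toLinearMap) D (Ω ∘ₗ g) :=
  .of_map_act_eq (h.measuring.comp f)
    (fun y p u => by rw [← actLift_map, ← hg, ← h.map_act_eq]; rfl)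
    (fun y p z hz => by
      rw [diag_comp, TensorProduct.map_comm, ← hg, ← h.map_coact _ _ _ hz]; rfl)

/-- As for measurings of Hopf algebroids, both comodule axioms are additive and can be checked at
elements `g y` after pullback. The measuring `(Ψ, ψ)` is assumed separately, because the images of
the maps `f` need not span `C`. -/
theorem isComoduleMeasuring_of_induction (hm : IsMeasuring H H' Ψ ψ) {D' : RightComodule k C}
    {Ω : D'.carrier →ₗ[k] P.P →ₗ[k] P'.P}
    (h : ∀ q : D'.carrier → Prop, q 0 → (∀ x y, q x → q y → q (x + y)) →
      (∀ (E : Type u) [AddCommGroup E] [Module k E] [Coalgebra k E] (f : E →ₗc[k] C)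
        (D : RightComodule k E) (g : D.carrier →ₗ[k] D'.carrier), IsHomOver D D' f g →
        IsComoduleMeasuring P P' (Ψ ∘ₗ f.toLinearMap) (ψ ∘ₗ f.toLinearMap) D (Ω ∘ₗ g) →
          ∀ y, q (g y)) → ∀ x, q x) :
    IsComoduleMeasuring P P' Ψ ψ D' Ω :=
  .of_map_act_eq hm
    (h _ (by simp) (fun x y hx hy p u => by simp only [map_add, LinearMap.add_apply, hx, hy])
      fun E _ _ _ f D g hg hD y p u => by
        rw [hg, actLift_map, ← hD.map_act_eq]; rfl)
    (h _ (by simp)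
      (fun x y hx hy p z hz => by simp only [map_add, LinearMap.add_apply, hx p z hz, hy p z hz])
      fun E _ _ _ f D g hg hD y p z hz => by
        rw [hg, ← TensorProduct.map_comm, ← diag_comp, ← hD.map_coact _ _ _ hz]; rfl)

/-- The comodule `D` corestricted along `f`. -/
def RightComodule.corestrict (D : RightComodule k E) (f : E →ₗc[k] C) : RightComodule k C where
  carrier := D.carrier
  coact := f.toLinearMap.lTensor _ ∘ₗ D.coact
  coassoc := by
    ext y
    have h₁ : ∀ w : D.carrier ⊗[k] E, TensorProduct.assoc k D.carrier C C
        ((f.toLinearMap.lTensor _ ∘ₗ D.coact).rTensor C (f.toLinearMap.lTensor _ w)) =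
        (TensorProduct.map f.toLinearMap f.toLinearMap).lTensor _
          (TensorProduct.assoc k D.carrier E E (D.coact.rTensor E w)) := by
      intro w
      induction w with
      | zero => simp
      | add x y hx hy => simp only [map_add, hx, hy]
      | tmul x y =>
        simp only [LinearMap.lTensor_tmul, LinearMap.rTensor_tmul, LinearMap.comp_apply]
        generalize D.coact x = v
        induction v with
        | zero => simp
        | add x y hx hy => simp only [add_tmul, map_add, hx, hy]
        | tmul x y => rfl
    have h₂ := LinearMap.congr_fun D.coassoc y
    simp only [LinearMap.comp_apply, LinearEquiv.coe_coe] at h₂ ⊢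
    refine (h₁ _).trans ?_
    rw [h₂, ← LinearMap.lTensor_comp_apply, ← LinearMap.lTensor_comp_apply, f.map_comp_comul]
  counit := by
    rw [← LinearMap.comp_assoc, ← LinearMap.lTensor_comp, f.counit_comp, D.counit]

theorem isHomOver_corestrict (D : RightComodule k E) (f : E →ₗc[k] C) :
    IsHomOver D (D.corestrict f) f LinearMap.id := fun _ => rfl

theorem IsComoduleMeasuring.corestrict (hm : IsMeasuring H H' Ψ ψ) {D : RightComodule k E}
    {f : E →ₗc[k] C} {Ω : D.carrier →ₗ[k] P.P →ₗ[k] P'.P}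
    (h : IsComoduleMeasuring P P' (Ψ ∘ₗ f.toLinearMap) (ψ ∘ₗ f.toLinearMap) D Ω) :
    IsComoduleMeasuring P P' Ψ ψ (D.corestrict f) Ω :=
  isComoduleMeasuring_of_induction hm fun _ _ _ hq x =>
    hq E f D LinearMap.id (isHomOver_corestrict D f) h x

theorem isHomOver_id {D D' : RightComodule k C} {g : D.carrier →ₗ[k] D'.carrier}
    (hg : RightComodule.IsHom D D' g) : IsHomOver D D' (CoalgHom.id k C) g :=
  LinearMap.congr_fun hg

/-! ### The universal comodule measuring -/

theorem rTensor_injective {X Y : Type u} [AddCommGroup X] [Module k X] [AddCommGroup Y]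
    [Module k Y] {i : X →ₗ[k] Y} (hi : Function.Injective i) (Z : Type u) [AddCommGroup Z]
    [Module k Z] : Function.Injective (i.rTensor Z) :=
  Module.Flat.rTensor_preserves_injective_linearMap i hi

namespace RightComodule

/-- A comodule structure on `V`, given by an injection into a comodule through which the coaction
factors. -/
def ofInjective (F : RightComodule k C) {V : Type u} [AddCommGroup V] [Module k V]
    (i : V →ₗ[k] F.carrier) (hi : Function.Injective i) (δ : V →ₗ[k] V ⊗[k] C)
    (hδ : ∀ v, i.rTensor C (δ v) = F.coact (i v)) : RightComodule k C where
  carrier := V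
  coact := δ
  coassoc := by
    ext v
    -- The axioms are checked in `F`, since `i` stays injective after tensoring.
    apply rTensor_injective hi (C ⊗[k] C)
    have h₁ : ∀ z : V ⊗[k] C, i.rTensor (C ⊗[k] C) (TensorProduct.assoc k V C C (δ.rTensor C z)) =
        TensorProduct.assoc k F.carrier C C (F.coact.rTensor C (i.rTensor C z)) := by
      intro z
      induction z with
      | zero => simp
      | add x y hx hy => simp only [map_add, hx, hy]
      | tmul x y =>
        rw [LinearMap.rTensor_tmul, LinearMap.rTensor_tmul, LinearMap.rTensor_tmul, ← hδ]
        generalize δ x = w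
        induction w with
        | zero => simp
        | add x y hx hy => simp only [add_tmul, map_add, hx, hy]
        | tmul x y => rfl
    have h₂ := LinearMap.congr_fun F.coassoc (i v)
    simp only [LinearMap.comp_apply, LinearEquiv.coe_coe] at h₂ ⊢
    rw [h₁, hδ, h₂, ← hδ]
    exact LinearMap.congr_fun ((LinearMap.lTensor_comp_rTensor _ _ _).trans
      (LinearMap.rTensor_comp_lTensor _ _ _).symm) (δ v)
  counit := by
    ext v
    apply rTensor_injective hi k
    have h₂ := LinearMap.congr_fun F.counit (i v)
    simp only [LinearMap.comp_apply] at h₂ ⊢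
    rw [← LinearMap.comp_apply, LinearMap.rTensor_comp_lTensor, ← LinearMap.lTensor_comp_rTensor,
      LinearMap.comp_apply, hδ, h₂]
    rfl

theorem IsHom.comp {D E F : RightComodule k C} {g : E.carrier →ₗ[k] F.carrier}
    {f : D.carrier →ₗ[k] E.carrier} (hg : IsHom E F g) (hf : IsHom D E f) : IsHom D F (g ∘ₗ f) := by
  rw [IsHom, ← LinearMap.comp_assoc, hg, LinearMap.comp_assoc, hf, LinearMap.rTensor_comp,
    LinearMap.comp_assoc]

theorem isHom_id (D : RightComodule k C) : IsHom D D LinearMap.id := by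
  rw [IsHom, LinearMap.rTensor_id]
  rfl

theorem IsHom.of_comp_injective {D E F : RightComodule k C} {g : E.carrier →ₗ[k] F.carrier}
    {f : D.carrier →ₗ[k] E.carrier} (hg : IsHom E F g) (hi : Function.Injective g)
    (h : IsHom D F (g ∘ₗ f)) : IsHom D E f := by
  ext y
  apply rTensor_injective hi C
  have h₁ := LinearMap.congr_fun hg (f y)
  have h₂ := LinearMap.congr_fun h y
  rw [LinearMap.rTensor_comp] at h₂
  exact h₁.symm.trans h₂

end RightComodule

open RightComodule

variable (P P' Ψ ψ)

/-- The sum of the images of all comodule measurings in the cofree comodule on `Hom(P, P')`. -/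
def maxMeasuring : Submodule k (cofree (k := k) C (P.P →ₗ[k] P'.P)).carrier :=
  ⨆ N : {N : Submodule k (cofree (k := k) C (P.P →ₗ[k] P'.P)).carrier //
    ∃ (D : RightComodule k C) (χ : D.carrier →ₗ[k] (cofree (k := k) C (P.P →ₗ[k] P'.P)).carrier),
      IsHom D (cofree C (P.P →ₗ[k] P'.P)) χ ∧
      IsComoduleMeasuring P P' Ψ ψ D (cofreeEval C (P.P →ₗ[k] P'.P) ∘ₗ χ) ∧
      N = LinearMap.range χ}, N.1

variable {P P' Ψ ψ}

theorem mem_maxMeasuring {D : RightComodule k C}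
    {χ : D.carrier →ₗ[k] (cofree (k := k) C (P.P →ₗ[k] P'.P)).carrier}
    (hχ : IsHom D (cofree C (P.P →ₗ[k] P'.P)) χ)
    (h : IsComoduleMeasuring P P' Ψ ψ D (cofreeEval C (P.P →ₗ[k] P'.P) ∘ₗ χ)) (y : D.carrier) :
    χ y ∈ maxMeasuring P P' Ψ ψ :=
  Submodule.mem_iSup_of_mem ⟨LinearMap.range χ, D, χ, hχ, h, rfl⟩ ⟨y, rfl⟩

/-- The image of a comodule map `χ` is stable under the coaction, as `χ y` coacts to `χ(y₍₀₎) ⊗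
y₍₁₎`. Sums inherit this. -/
theorem coact_mem_maxMeasuring (x : maxMeasuring P P' Ψ ψ) :
    (cofree C (P.P →ₗ[k] P'.P)).coact x ∈
      LinearMap.range ((maxMeasuring P P' Ψ ψ).subtype.rTensor C) := by
  suffices h : maxMeasuring P P' Ψ ψ ≤
      (LinearMap.range ((maxMeasuring P P' Ψ ψ).subtype.rTensor C)).comap
        (cofree C (P.P →ₗ[k] P'.P)).coact from h x.2
  refine iSup_le ?_
  rintro ⟨_, D, χ, hχ, hD, rfl⟩ _ ⟨y, rfl⟩
  refine ⟨(χ.codRestrict _ (mem_maxMeasuring hχ hD)).rTensor C (D.coact y), ?_⟩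
  rw [← LinearMap.comp_apply, ← LinearMap.rTensor_comp, LinearMap.subtype_comp_codRestrict]
  exact (LinearMap.congr_fun hχ y).symm

variable (P P' Ψ ψ)

theorem exists_maxMeasuring_coact : ∃ δ : maxMeasuring P P' Ψ ψ →ₗ[k] maxMeasuring P P' Ψ ψ ⊗[k] C,
    ∀ x, (maxMeasuring P P' Ψ ψ).subtype.rTensor C (δ x) =
      (cofree C (P.P →ₗ[k] P'.P)).coact ((maxMeasuring P P' Ψ ψ).subtype x) :=
  exists_lift_of_injective (rTensor_injective (Submodule.injective_subtype _) C)
    ((cofree C (P.P →ₗ[k] P'.P)).coact ∘ₗ (maxMeasuring P P' Ψ ψ).subtype) coact_mem_maxMeasuring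

/-- The largest measuring subcomodule of the cofree comodule on `Hom(P, P')`. -/
def maxComodule : RightComodule k C :=
  (cofree C (P.P →ₗ[k] P'.P)).ofInjective (maxMeasuring P P' Ψ ψ).subtype
    (Submodule.injective_subtype _) (exists_maxMeasuring_coact P P' Ψ ψ).choose
    (exists_maxMeasuring_coact P P' Ψ ψ).choose_spec

/-- The inclusion of the largest measuring subcomodule. -/
def maxIncl : (maxComodule P P' Ψ ψ).carrier →ₗ[k] (cofree (k := k) C (P.P →ₗ[k] P'.P)).carrier :=
  (maxMeasuring P P' Ψ ψ).subtype

theorem maxIncl_injective : Function.Injective (maxIncl P P' Ψ ψ) :=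
  Submodule.injective_subtype _

theorem isHom_maxIncl : IsHom (maxComodule P P' Ψ ψ) (cofree C (P.P →ₗ[k] P'.P))
    (maxIncl P P' Ψ ψ) :=
  LinearMap.ext fun x => ((exists_maxMeasuring_coact P P' Ψ ψ).choose_spec x).symm

variable {P P' Ψ ψ}

theorem exists_lift_maxComodule {D : RightComodule k C}
    {χ : D.carrier →ₗ[k] (cofree (k := k) C (P.P →ₗ[k] P'.P)).carrier}
    (hχ : IsHom D (cofree C (P.P →ₗ[k] P'.P)) χ)
    (h : IsComoduleMeasuring P P' Ψ ψ D (cofreeEval C (P.P →ₗ[k] P'.P) ∘ₗ χ)) :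
    ∃ g : D.carrier →ₗ[k] (maxComodule P P' Ψ ψ).carrier,
      IsHom D (maxComodule P P' Ψ ψ) g ∧ maxIncl P P' Ψ ψ ∘ₗ g = χ := by
  let g : D.carrier →ₗ[k] (maxComodule P P' Ψ ψ).carrier :=
    χ.codRestrict (maxMeasuring P P' Ψ ψ) (mem_maxMeasuring hχ h)
  have hg : maxIncl P P' Ψ ψ ∘ₗ g = χ := LinearMap.subtype_comp_codRestrict _ _ _
  exact ⟨g, (isHom_maxIncl P P' Ψ ψ).of_comp_injective (maxIncl_injective P P' Ψ ψ) (hg ▸ hχ), hg⟩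

/-- The comodule is generated by elements `χ y`, with `χ` coming from a comodule measuring. Such a
`χ` factors through it by a comodule map, so the axioms pull back to ones already known. -/
theorem isComoduleMeasuring_maxComodule (hm : IsMeasuring H H' Ψ ψ) :
    IsComoduleMeasuring P P' Ψ ψ (maxComodule P P' Ψ ψ)
      (cofreeEval C (P.P →ₗ[k] P'.P) ∘ₗ maxIncl P P' Ψ ψ) :=
  isComoduleMeasuring_of_induction hm fun q h0 hadd hq => by
    rintro ⟨x, hx⟩
    refine Submodule.iSup_induction' _ (motive := fun x hx => q ⟨x, hx⟩) ?_ h0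
      (fun x y hx hy => hadd ⟨x, hx⟩ ⟨y, hy⟩) hx
    rintro ⟨_, D, χ, hχ, hD, rfl⟩ _ ⟨y, rfl⟩
    obtain ⟨g, hg, hgχ⟩ := exists_lift_maxComodule hχ hD
    have h := hq C (CoalgHom.id k C) D g (isHomOver_id hg)
      (by rw [LinearMap.comp_assoc, hgχ]; exact hD) y
    have h' : g y = ⟨χ y, mem_maxMeasuring hχ hD y⟩ :=
      Subtype.ext (LinearMap.congr_fun hgχ y)
    rwa [h'] at h

/-- The universal comodule measuring, as a subcomodule of the cofree comodule on `Hom(P, P')`. -/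
def universalComoduleMeasuring (hm : IsMeasuring H H' Ψ ψ) :
    UniversalComoduleMeasuring P P' Ψ ψ where
  Q := maxComodule P P' Ψ ψ
  Θ := cofreeEval C (P.P →ₗ[k] P'.P) ∘ₗ maxIncl P P' Ψ ψ
  measuring := isComoduleMeasuring_maxComodule hm
  universal D Ω h := by
    -- `Ω` extends to a comodule map into the cofree comodule, whose image is among those summed in
    -- `maxMeasuring`. Uniqueness is inherited through the injective inclusion.
    obtain ⟨χ, ⟨hχ, hev⟩, huniq⟩ := cofree_universal C (P.P →ₗ[k] P'.P) D Ω
    obtain ⟨g, hg, hgχ⟩ := exists_lift_maxComodule (P := P) (P' := P') (Ψ := Ψ) (ψ := ψ) hχ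
      (hev.symm ▸ h)
    refine ⟨g, ⟨hg, by rw [LinearMap.comp_assoc, hgχ, hev]⟩, ?_⟩
    rintro g' ⟨hg', hev'⟩
    have h' := huniq (maxIncl P P' Ψ ψ ∘ₗ g') ⟨(isHom_maxIncl P P' Ψ ψ).comp hg', hev'⟩
    rw [← hgχ] at h'
    exact LinearMap.ext fun y => maxIncl_injective P P' Ψ ψ (LinearMap.congr_fun h' y)

/-- Universality gives comparison maps with the constructed model in both directions. The composite
on `Q` is the identity, so `Q` embeds in the model and with it in the cofree comodule. -/
theorem UniversalComoduleMeasuring.exists_embedding (Q : UniversalComoduleMeasuring P P' Ψ ψ) :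
    ∃ ι : Q.Q.carrier →ₗ[k] (cofree (k := k) C (P.P →ₗ[k] P'.P)).carrier,
      Function.Injective ι ∧ IsHom Q.Q (cofree C (P.P →ₗ[k] P'.P)) ι ∧
        cofreeEval C (P.P →ₗ[k] P'.P) ∘ₗ ι = Q.Θ := by
  let R := universalComoduleMeasuring (P := P) (P' := P') Q.measuring.measuring
  obtain ⟨χ, ⟨hχ, hχΘ⟩, -⟩ := R.universal Q.Q Q.Θ Q.measuring
  obtain ⟨χ', ⟨hχ', hχΘ'⟩, -⟩ := Q.universal R.Q R.Θ R.measuring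
  have h : χ' ∘ₗ χ = LinearMap.id := (Q.universal Q.Q Q.Θ Q.measuring).unique
    ⟨hχ'.comp hχ, by rw [← LinearMap.comp_assoc, hχΘ', hχΘ]⟩ ⟨isHom_id _, rfl⟩
  have hinj : Function.Injective χ := Function.LeftInverse.injective (LinearMap.congr_fun h)
  exact ⟨maxIncl P P' Ψ ψ ∘ₗ χ, (maxIncl_injective P P' Ψ ψ).comp hinj,
    (isHom_maxIncl P P' Ψ ψ).comp hχ, hχΘ⟩

end Comodule

/-! ### The enrichment -/

theorem isComoduleMeasuring_id {H : HopfAlgebroid k} (P : SAYDModule H) :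
    IsComoduleMeasuring P P (LinearMap.toSpanSingleton k (H.U →ₗ[k] H.U) LinearMap.id)
      (LinearMap.toSpanSingleton k (H.A →ₗ[k] H.A) LinearMap.id) (ComodPair.unitD (k := k))
      (LinearMap.toSpanSingleton k (P.P →ₗ[k] P.P) LinearMap.id) :=
  .of_map_act_eq (isMeasuring_id H)
    (fun (y : k) p u => by
      change y • _ = actLift P _ _ p u ((1 : k) ⊗ₜ[k] y)
      rw [actLift_tmul, LinearMap.toSpanSingleton_apply, LinearMap.toSpanSingleton_apply, one_smul,
        LinearMap.smul_apply, LinearMap.id_apply, MulOpposite.op_smul, smul_assoc]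
      rfl)
    (fun (y : k) p z hz => by
      change P.coact (y • p) = P.proj (diag _ _ (TensorProduct.comm k k k ((1 : k) ⊗ₜ[k] y)) z)
      rw [TensorProduct.comm_tmul, diag_tmul, LinearMap.toSpanSingleton_apply,
        LinearMap.toSpanSingleton_apply, one_smul, TensorProduct.map_smul_left,
        LinearMap.smul_apply, TensorProduct.map_id, map_smul, map_smul, LinearMap.id_apply, hz])

theorem comm_tensorTensorTensorComm {D C D' C' : Type u} [AddCommGroup D] [Module k D]
    [AddCommGroup C] [Module k C] [AddCommGroup D'] [Module k D'] [AddCommGroup C'] [Module k C']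
    (w : D ⊗[k] C) (w' : D' ⊗[k] C') :
    TensorProduct.comm k _ _ (TensorProduct.tensorTensorTensorComm k D C D' C' (w ⊗ₜ w')) =
      TensorProduct.tensorTensorTensorComm k C D C' D'
        (TensorProduct.comm k _ _ w ⊗ₜ TensorProduct.comm k _ _ w') := by
  induction w with
  | zero => simp
  | add x y hx hy => simp only [add_tmul, map_add, hx, hy]
  | tmul x y =>
    induction w' with
    | zero => simp
    | add x y hx hy => simp only [tmul_add, map_add, hx, hy]
    | tmul x y => rfl

theorem IsComoduleMeasuring.compMap {X Y : ComodPair k} {H H' H'' : HopfAlgebroid k}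
    {P : SAYDModule H} {P' : SAYDModule H'} {P'' : SAYDModule H''}
    {Ψ : X.C →ₗ[k] H.U →ₗ[k] H'.U} {ψ : X.C →ₗ[k] H.A →ₗ[k] H'.A}
    {Ω : X.D.carrier →ₗ[k] P.P →ₗ[k] P'.P} (h : IsComoduleMeasuring P P' Ψ ψ X.D Ω)
    {Ψ' : Y.C →ₗ[k] H'.U →ₗ[k] H''.U} {ψ' : Y.C →ₗ[k] H'.A →ₗ[k] H''.A}
    {Ω' : Y.D.carrier →ₗ[k] P'.P →ₗ[k] P''.P} (h' : IsComoduleMeasuring P' P'' Ψ' ψ' Y.D Ω') :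
    IsComoduleMeasuring P P'' (compMap Ψ Ψ') (compMap ψ ψ') (ComodPair.tensorD X Y)
      (compMap Ω Ω') :=
  .of_map_act_eq (h.measuring.compMap h'.measuring)
    (fun (x : X.D.carrier ⊗[k] Y.D.carrier) p u => by
      change HopfMeasuring.compMap Ω Ω' x _ =
        actLift P'' _ (HopfMeasuring.compMap Ω Ω') p u (ComodPair.tensorCoact X Y x)
      induction x with
      | zero => simp
      | add x y hx hy => simp only [map_add, LinearMap.add_apply, hx, hy]
      | tmul x y =>
        rw [compMap_tmul, LinearMap.comp_apply, h.map_act_eq]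
        change _ = actLift P'' _ _ p u (TensorProduct.tensorTensorTensorComm k _ _ _ _
          (X.D.coact x ⊗ₜ Y.D.coact y))
        generalize X.D.coact x = w
        induction w with
        | zero => simp
        | add a b ha hb => simp only [add_tmul, map_add, ha, hb]
        | tmul d c =>
          rw [actLift_tmul, h'.map_act_eq]
          generalize Y.D.coact y = w'
          induction w' with
          | zero => simp
          | add a b ha hb => simp only [tmul_add, map_add, ha, hb]
          | tmul d' c' => rfl)
    (fun (x : X.D.carrier ⊗[k] Y.D.carrier) p z hz => by
      change P''.coact (HopfMeasuring.compMap Ω Ω' x p) = P''.proj (diag _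
        (HopfMeasuring.compMap Ω Ω') (TensorProduct.comm k _ _ (ComodPair.tensorCoact X Y x)) z)
      induction x with
      | zero => simp
      | add x y hx hy => simp only [map_add, LinearMap.add_apply, hx, hy]
      | tmul x y =>
        change _ = P''.proj (diag _ _ (TensorProduct.comm k _ _
          (TensorProduct.tensorTensorTensorComm k _ _ _ _ (X.D.coact x ⊗ₜ Y.D.coact y))) z)
        rw [comm_tensorTensorTensorComm, diag_compMap, compMap_tmul, LinearMap.comp_apply]
        exact h'.map_coact y _ _ (h.map_coact x p z hz).symm)

section HomObj

variable (M : ∀ H H' : HopfAlgebroid k, UniversalMeasuring H H')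
  (Q : ∀ X Y : SAYDPair k, UniversalComoduleMeasuring X.M Y.M (M X.H Y.H).Φ (M X.H Y.H).φ)

/-- A map into `homObj X Y` represents the given families of linear maps on `U`, `A` and `P`. -/
structure Represents {X Y : SAYDPair k} {Z : ComodPair k} (F : Z ⟶ homObj M Q X Y)
    (Ψ : Z.C →ₗ[k] X.H.U →ₗ[k] Y.H.U) (ψ : Z.C →ₗ[k] X.H.A →ₗ[k] Y.H.A)
    (Ω : Z.D.carrier →ₗ[k] X.M.P →ₗ[k] Y.M.P) : Prop where
  onU : (M X.H Y.H).Φ ∘ₗ F.f.toLinearMap = Ψ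
  onA : (M X.H Y.H).φ ∘ₗ F.f.toLinearMap = ψ
  onP : (Q X Y).Θ ∘ₗ F.g = Ω

variable {X Y : SAYDPair k} {Z : ComodPair k}
  {Ψ : Z.C →ₗ[k] X.H.U →ₗ[k] Y.H.U} {ψ : Z.C →ₗ[k] X.H.A →ₗ[k] Y.H.A}
  {Ω : Z.D.carrier →ₗ[k] X.M.P →ₗ[k] Y.M.P}

theorem isHom_corestrict_iff {C E : Type u} [AddCommGroup C] [Module k C] [Coalgebra k C]
    [AddCommGroup E] [Module k E] [Coalgebra k E] {D : RightComodule k E} {D' : RightComodule k C}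
    {f : E →ₗc[k] C} {g : D.carrier →ₗ[k] D'.carrier} :
    RightComodule.IsHom (D.corestrict f) D' g ↔
      D'.coact ∘ₗ g = TensorProduct.map g f.toLinearMap ∘ₗ D.coact := by
  rw [← LinearMap.rTensor_comp_lTensor, LinearMap.comp_assoc]
  rfl

/-- The coalgebra part `ξ` comes from the universal measuring. After corestriction along `ξ`, the
comodule of `Z` measures over `M_c`, and the universal comodule measuring supplies the other part.
-/
theorem exists_represents (h : IsComoduleMeasuring X.M Y.M Ψ ψ Z.D Ω) :
    ∃ F : Z ⟶ homObj M Q X Y, Represents M Q F Ψ ψ Ω := by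
  obtain ⟨ξ, ⟨hU, hA⟩, -⟩ := (M X.H Y.H).universal Z.C Ψ ψ h.measuring
  obtain rfl : (M X.H Y.H).Φ ∘ₗ ξ.toLinearMap = Ψ := LinearMap.ext hU
  obtain rfl : (M X.H Y.H).φ ∘ₗ ξ.toLinearMap = ψ := LinearMap.ext hA
  obtain ⟨χ, ⟨hχ, hP⟩, -⟩ := (Q X Y).universal (Z.D.corestrict ξ) Ω
    (h.corestrict (M X.H Y.H).measuring)
  exact ⟨⟨ξ, χ, isHom_corestrict_iff.1 hχ⟩, rfl, rfl, hP⟩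

variable {M Q}

/-- The coalgebra parts agree by universality of `M_c`. Only then are both comodule parts maps from
the same corestricted comodule, where universality of `Q` applies. -/
theorem Represents.hom_ext {F G : Z ⟶ homObj M Q X Y} (hF : Represents M Q F Ψ ψ Ω)
    (hG : Represents M Q G Ψ ψ Ω) : F = G := by
  obtain ⟨f, g, hg⟩ := F
  obtain ⟨f', g', hg'⟩ := G
  have hf := (M X.H Y.H).universal Z.C _ _ ((M X.H Y.H).measuring.comp f)
  obtain rfl : f = f' := hf.unique ⟨fun _ => rfl, fun _ => rfl⟩
    ⟨LinearMap.congr_fun (hG.onU.trans hF.onU.symm), LinearMap.congr_fun (hG.onA.trans hF.onA.symm)⟩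
  have h : IsComoduleMeasuring X.M Y.M (M X.H Y.H).Φ (M X.H Y.H).φ (Z.D.corestrict f)
      ((Q X Y).Θ ∘ₗ g) :=
    ((Q X Y).measuring.comp (LinearMap.congr_fun hg)).corestrict (M X.H Y.H).measuring
  obtain rfl : g = g' := ((Q X Y).universal _ _ h).unique ⟨isHom_corestrict_iff.2 hg, rfl⟩
    ⟨isHom_corestrict_iff.2 hg', hG.onP.trans hF.onP.symm⟩
  rfl

variable (M Q)

theorem exists_unit (X : SAYDPair k) : ∃ j : 𝟙_ (ComodPair k) ⟶ homObj M Q X X,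
    IsUnitMap M Q X j := by
  obtain ⟨j, hj⟩ := exists_represents M Q (X := X) (Y := X) (Z := ComodPair.unitPair)
    (isComoduleMeasuring_id X.M)
  exact ⟨j, LinearMap.congr_fun hj.onU, LinearMap.congr_fun hj.onA, LinearMap.congr_fun hj.onP⟩

theorem exists_comp (X Y Z : SAYDPair k) :
    ∃ c : homObj M Q X Y ⊗ homObj M Q Y Z ⟶ homObj M Q X Z, IsCompMap M Q X Y Z c := by
  obtain ⟨c, hc⟩ := exists_represents M Q (X := X) (Y := Z)
    (Z := ComodPair.tensorPair (homObj M Q X Y) (homObj M Q Y Z))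
    (IsComoduleMeasuring.compMap (X := homObj M Q X Y) (Y := homObj M Q Y Z)
      (Q X Y).measuring (Q Y Z).measuring)
  exact ⟨c, fun x x' => LinearMap.congr_fun hc.onU (x ⊗ₜ x'),
    fun x x' => LinearMap.congr_fun hc.onA (x ⊗ₜ x'),
    fun x x' => LinearMap.congr_fun hc.onP (x ⊗ₜ x')⟩

/-- The category of pairs of a Hopf algebroid and an SAYD module over it, enriched over the global
category of comodules. -/
abbrev enrichedCategory : EnrichedCategory (ComodPair k) (SAYDPair k) where
  Hom := homObj M Q
  id X := (exists_unit M Q X).choose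
  comp X Y Z := (exists_comp M Q X Y Z).choose
  id_comp X Y := by
    have hj := (exists_unit M Q X).choose_spec
    have hc := (exists_comp M Q X X Y).choose_spec
    -- Both sides represent the universal families themselves. The inverse unitor inserts `1 : k`,
    -- which the unit sends to an element acting as the identity.
    refine Represents.hom_ext (Ψ := (M X.H Y.H).Φ) (ψ := (M X.H Y.H).φ) (Ω := (Q X Y).Θ)
      ⟨LinearMap.ext fun x => (hc.onU _ x).trans ?_, LinearMap.ext fun x => (hc.onA _ x).trans ?_,
        LinearMap.ext fun y => (hc.onP _ y).trans ?_⟩ ⟨rfl, rfl, rfl⟩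
    · exact congrArg _ ((hj.onU 1).trans (one_smul _ _))
    · exact congrArg _ ((hj.onA 1).trans (one_smul _ _))
    · exact congrArg _ ((hj.onP 1).trans (one_smul _ _))
  comp_id X Y := by
    have hj := (exists_unit M Q Y).choose_spec
    have hc := (exists_comp M Q X Y Y).choose_spec
    refine Represents.hom_ext (Ψ := (M X.H Y.H).Φ) (ψ := (M X.H Y.H).φ) (Ω := (Q X Y).Θ)
      ⟨LinearMap.ext fun x => (hc.onU x _).trans ?_, LinearMap.ext fun x => (hc.onA x _).trans ?_,
        LinearMap.ext fun y => (hc.onP y _).trans ?_⟩ ⟨rfl, rfl, rfl⟩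
    · exact congrArg (· ∘ₗ _) ((hj.onU 1).trans (one_smul _ _))
    · exact congrArg (· ∘ₗ _) ((hj.onA 1).trans (one_smul _ _))
    · exact congrArg (· ∘ₗ _) ((hj.onP 1).trans (one_smul _ _))
  assoc W X Y Z := by
    have h₁ := (exists_comp M Q W X Y).choose_spec
    have h₂ := (exists_comp M Q W Y Z).choose_spec
    have h₃ := (exists_comp M Q X Y Z).choose_spec
    have h₄ := (exists_comp M Q W X Z).choose_spec
    -- The represented families are those of one side by definition. On pure tensors `x ⊗ (y ⊗ z)`
    -- both sides induce the triple composite of linear maps.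
    refine Represents.hom_ext ⟨rfl, rfl, rfl⟩ ⟨?_, ?_, ?_⟩
    · refine TensorProduct.ext (LinearMap.ext fun x => TensorProduct.ext' fun y z => ?_)
      exact (h₄.onU _ _).trans ((congrArg (· ∘ₗ _) (h₃.onU y z)).trans
        ((h₂.onU _ _).trans (congrArg _ (h₁.onU x y))).symm)
    · refine TensorProduct.ext (LinearMap.ext fun x => TensorProduct.ext' fun y z => ?_)
      exact (h₄.onA _ _).trans ((congrArg (· ∘ₗ _) (h₃.onA y z)).trans
        ((h₂.onA _ _).trans (congrArg _ (h₁.onA x y))).symm)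
    · refine TensorProduct.ext (LinearMap.ext fun x => TensorProduct.ext' fun y z => ?_)
      exact (h₄.onP _ _).trans ((congrArg (· ∘ₗ _) (h₃.onP y z)).trans
        ((h₂.onP _ _).trans (congrArg _ (h₁.onP x y))).symm)

end HomObj

end HopfMeasuring

end

theorem theorem5p9 (k : Type u) [Field k] :
    -- the universal comodule measuring, a subcomodule of the cofree comodule on `Hom(P, P')`
    (∀ (H H' : HopfAlgebroid k) (P : SAYDModule H) (P' : SAYDModule H')
      (C : Type u) [AddCommGroup C] [Module k C] [Coalgebra k C] [Coalgebra.IsCocomm k C]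
      (Ψ : C →ₗ[k] H.U →ₗ[k] H'.U) (ψ : C →ₗ[k] H.A →ₗ[k] H'.A), IsMeasuring H H' Ψ ψ →
        Nonempty (UniversalComoduleMeasuring P P' Ψ ψ) ∧
        ∀ Q : UniversalComoduleMeasuring P P' Ψ ψ,
          ∃ ι : Q.Q.carrier →ₗ[k] (RightComodule.cofree (k := k) C (P.P →ₗ[k] P'.P)).carrier,
            Function.Injective ι ∧
            RightComodule.IsHom Q.Q (RightComodule.cofree C (P.P →ₗ[k] P'.P)) ι ∧
            RightComodule.cofreeEval C (P.P →ₗ[k] P'.P) ∘ₗ ι = Q.Θ) ∧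
    -- the universal measuring coalgebra
    (∀ H H' : HopfAlgebroid k, Nonempty (UniversalMeasuring H H')) ∧
    -- the enrichment
    ∀ (M : ∀ H H' : HopfAlgebroid k, UniversalMeasuring H H')
      (Q : ∀ X Y : SAYDPair k, UniversalComoduleMeasuring X.M Y.M (M X.H Y.H).Φ (M X.H Y.H).φ),
      ∃ (E : EnrichedCategory (ComodPair k) (SAYDPair k))
        (hE : ∀ X Y : SAYDPair k, E.Hom X Y = homObj M Q X Y),
        (∀ X, IsUnitMap M Q X (E.id X ≫ eqToHom (hE X X))) ∧
        ∀ X Y Z, IsCompMap M Q X Y Z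
          ((eqToHom (hE X Y).symm ⊗ₘ eqToHom (hE Y Z).symm) ≫ E.comp X Y Z ≫
            eqToHom (hE X Z)) := by
  refine ⟨fun H H' P P' C _ _ _ _ Ψ ψ h => ⟨⟨universalComoduleMeasuring h⟩,
    fun Q => Q.exists_embedding⟩, fun H H' => ⟨universalMeasuring H H'⟩, fun M Q =>
    ⟨enrichedCategory M Q, fun _ _ => rfl, fun X => ?_, fun X Y Z => ?_⟩⟩
  -- The hom-objects agree definitionally, so every `eqToHom` is an identity.
  · change IsUnitMap M Q X ((exists_unit M Q X).choose ≫ 𝟙 _)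
    rw [Category.comp_id]
    exact (exists_unit M Q X).choose_spec
  · change IsCompMap M Q X Y Z
      ((𝟙 _ ⊗ₘ 𝟙 _) ≫ (exists_comp M Q X Y Z).choose ≫ 𝟙 _)
    rw [Category.comp_id, id_tensorHom_id, Category.id_comp]
    exact (exists_comp M Q X Y Z).choose_spec
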